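/- Let $(M,g)$ be a smooth Riemannian manifold of real dimension $4$ with a smooth $g$-orthogonal almost complex structure $J$ that is integrable, i.e. whose Nijenhuis tensor $N(A,B)=[JA,JB]-[A,B]-J[JA,B]-J[A,JB]$ vanishes (a Hermitian surface). Let $\omega(X,Y)=g(JX,Y)$ be the fundamental $2$-form, let $J$ act on $1$-forms by $(J\alpha)(X)=-\alpha(JX)$, let $\nabla$ be the Levi-Civita connection, with curvature tensor $R$, and let $\delta$ be the codifferential, $\delta\beta=-\sum_i(\nabla_{e_i}\beta)(e_i,\cdot)$ for local orthonormal frames $(e_i)$. Let $\theta=J\delta\omega$ be the Lee form (equivalently, $d\omega=\theta\wedge\omega$). For a $2$-tensor $\psi$ denote by $\psi''(X,Y)=\tfrac12\big(\psi(X,Y)-\psi(JX,JY)\big)$ its $J$-anti-invariant part. Then $(M,g,J)$ satisfies Gray's first condition $$R_{XYZW}=R_{XY\,JZ\,JW}\quad\text{for all tangent vectors }X,Y,Z,W$$ if and only if both $$2\,\delta\theta=-|\theta|^2\qquad\text{and}\qquad(\nabla\theta)''=-\tfrac14\big(\theta\otimes\theta-J\theta\otimes J\theta\big)$$ hold on $M$,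 where $(\nabla\theta)(X,Y)=(\nabla_X\theta)(Y)$. -/

import Mathlib

open Bundle FiberBundle VectorField
open scoped Manifold ContDiff

noncomputable section

namespace HermitianSurface

section LeviCivita

variable {E : Type*} [NormedAddCommGroup E] [NormedSpace ℝ E]
  {H : Type*} [TopologicalSpace H] (I : ModelWithCorners ℝ E H)
  {M : Type*} [TopologicalSpace M] [ChartedSpace H M] [IsManifold I ∞ M]
  [RiemannianBundle (fun x : M ↦ TangentSpace I x)]
  
/-- The right-hand side of the Koszul formula for `2 ⟨∇_X Y, Z⟩`. -/
def koszul (Y X Z : Π x : M, TangentSpace I x) (x : M) : ℝ :=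
  mvfderiv I (fun y ↦ inner ℝ (Y y) (Z y)) x (X x)
    + mvfderiv I (fun y ↦ inner ℝ (Z y) (X y)) x (Y x)
    - mvfderiv I (fun y ↦ inner ℝ (X y) (Y y)) x (Z x)
    + inner ℝ (mlieBracket I X Y x) (Z x)
    - inner ℝ (mlieBracket I Y Z x) (X x)
    - inner ℝ (mlieBracket I X Z x) (Y x)

variable {I}

theorem eq_of_forall_inner {x : M} {v w : TangentSpace I x}
    (h : ∀ Z : Π x : M, TangentSpace I x, MDiffAt (T% Z) x →
      (inner ℝ v (Z x) : ℝ) = inner ℝ w (Z x)) : v = w := by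
  refine ext_inner_right ℝ fun z ↦ ?_
  simpa using h (extend E z) (mdifferentiableAt_extend I E z)

variable [IsContMDiffRiemannianBundle I ∞ E (fun x : M ↦ TangentSpace I x)]

theorem mdifferentiableAt_inner {x : M} {X Y : Π x : M, TangentSpace I x}
    (hX : MDiffAt (T% X) x) (hY : MDiffAt (T% Y) x) :
    MDiffAt (fun y ↦ (inner ℝ (X y) (Y y) : ℝ)) x :=
  MDifferentiableAt.inner_bundle (E := fun x : M ↦ TangentSpace I x) (F := E) (b := fun y ↦ y)
    (IB := I) hX hY

variable [FiniteDimensional ℝ E]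

theorem koszul_tensorial_left {x : M} {Y Z : Π x : M, TangentSpace I x}
    (hY : MDiffAt (T% Y) x) (hZ : MDiffAt (T% Z) x) :
    TensorialAt I E (koszul I Y · Z x) x where
  smul {f X} hf hX := by
    have h1 := mvfderiv_fun_mul hf (mdifferentiableAt_inner hZ hX)
    have h2 := mvfderiv_fun_mul hf (mdifferentiableAt_inner hX hY)
    simp [koszul, inner_smul_left, inner_smul_right, h1, h2, inner_add_left,
      mlieBracket_smul_left hf hX]
    rw [real_inner_comm (Y x) (X x), real_inner_comm (Z x) (X x)]
    ring
  add {X X'} hX hX' := by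
    have h1 := mvfderiv_fun_add (mdifferentiableAt_inner hZ hX) (mdifferentiableAt_inner hZ hX')
    have h2 := mvfderiv_fun_add (mdifferentiableAt_inner hX hY) (mdifferentiableAt_inner hX' hY)
    simp [koszul, h1, h2, inner_add_left, inner_add_right,
      mlieBracket_add_left hX hX']
    ring

theorem koszul_tensorial_right {x : M} {Y X : Π x : M, TangentSpace I x}
    (hY : MDiffAt (T% Y) x) (hX : MDiffAt (T% X) x) :
    TensorialAt I E (koszul I Y X · x) x where
  smul {f Z} hf hZ := by
    have h1 := mvfderiv_fun_mul hf (mdifferentiableAt_inner hY hZ)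
    have h2 := mvfderiv_fun_mul hf (mdifferentiableAt_inner hZ hX)
    simp [koszul, inner_smul_left, inner_smul_right, h1, h2, inner_add_left,
      mlieBracket_smul_right hf hZ]
    rw [real_inner_comm (Y x) (Z x)]
    ring
  add {Z Z'} hZ hZ' := by
    have h1 := mvfderiv_fun_add (mdifferentiableAt_inner hY hZ) (mdifferentiableAt_inner hY hZ')
    have h2 := mvfderiv_fun_add (mdifferentiableAt_inner hZ hX) (mdifferentiableAt_inner hZ' hX)
    simp [koszul, h1, h2, inner_add_left, inner_add_right,
      mlieBracket_add_right hZ hZ']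
    ring

instance (x : M) : FiniteDimensional ℝ (TangentSpace I x) :=
  inferInstanceAs (FiniteDimensional ℝ E)

/-- The Koszul formula as a bilinear form in the values of `X` and `Z` at `x`. -/
def koszulForm {Y : Π x : M, TangentSpace I x} {x : M} (hY : MDiffAt (T% Y) x) :
    TangentSpace I x →L[ℝ] TangentSpace I x →L[ℝ] ℝ :=
  TensorialAt.mkHom₂ (F := E) (F' := E) (fun X Z ↦ koszul I Y X Z x) x
    (fun _ hZ ↦ koszul_tensorial_left hY hZ) (fun _ hX ↦ koszul_tensorial_right hY hX)

theorem koszulForm_apply {Y X Z : Π x : M, TangentSpace I x} {x : M} (hY : MDiffAt (T% Y) x)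
    (hX : MDiffAt (T% X) x) (hZ : MDiffAt (T% Z) x) :
    koszulForm hY (X x) (Z x) = koszul I Y X Z x :=
  TensorialAt.mkHom₂_apply (F := E) (F' := E) (fun _ hZ ↦ koszul_tensorial_left hY hZ)
    (fun _ hX ↦ koszul_tensorial_right hY hX) hX hZ

open scoped Classical in
/-- `∇Y` at `x`, obtained from the Koszul formula with the help of an orthonormal basis of `T_x M`.
The value at a vector field that is not differentiable at `x` is irrelevant. -/
def leviCivitaFun (Y : Π y : M, TangentSpace I y) (x : M) :
    TangentSpace I x →L[ℝ] TangentSpace I x :=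
  if hY : MDiffAt (T% Y) x then
    ∑ i, ((2⁻¹ : ℝ) • (koszulForm hY).flip (stdOrthonormalBasis ℝ (TangentSpace I x) i)).smulRight
      (stdOrthonormalBasis ℝ (TangentSpace I x) i)
  else 0

theorem inner_leviCivitaFun {Y X Z : Π x : M, TangentSpace I x} {x : M} (hY : MDiffAt (T% Y) x)
    (hX : MDiffAt (T% X) x) (hZ : MDiffAt (T% Z) x) :
    inner ℝ (leviCivitaFun Y x (X x)) (Z x) = 2⁻¹ * koszul I Y X Z x := by
  rw [← koszulForm_apply hY hX hZ, leviCivitaFun, dif_pos hY]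
  generalize Z x = z
  conv_rhs => rw [← (stdOrthonormalBasis ℝ (TangentSpace I x)).sum_repr z]
  simp [sum_inner, inner_smul_left, Finset.mul_sum, OrthonormalBasis.repr_apply_apply]
  refine Finset.sum_congr rfl fun i _ ↦ ?_
  ring

theorem isCovariantDerivativeOn_leviCivitaFun :
    IsCovariantDerivativeOn E (leviCivitaFun (I := I) (M := M)) Set.univ where
  add {Y Y'} x hY hY' _ := by
    ext v
    obtain ⟨X, hX, rfl⟩ : ∃ X : Π x : M, TangentSpace I x, MDiffAt (T% X) x ∧ X x = v :=
      ⟨extend E v, mdifferentiableAt_extend I E v, by simp⟩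
    refine eq_of_forall_inner fun Z hZ ↦ ?_
    have hYY : MDiffAt (T% (Y + Y')) x := mdifferentiableAt_add_section hY hY'
    have h1 := mvfderiv_fun_add (mdifferentiableAt_inner hY hZ) (mdifferentiableAt_inner hY' hZ)
    have h2 := mvfderiv_fun_add (mdifferentiableAt_inner hX hY) (mdifferentiableAt_inner hX hY')
    rw [add_apply, inner_add_left, inner_leviCivitaFun hYY hX hZ,
      inner_leviCivitaFun hY hX hZ, inner_leviCivitaFun hY' hX hZ]
    simp [koszul, h1, h2, inner_add_left, inner_add_right,
      mlieBracket_add_left hY hY', mlieBracket_add_right hY hY']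
    ring
  leibniz {Y f} x hY hf _ := by
    ext v
    obtain ⟨X, hX, rfl⟩ : ∃ X : Π x : M, TangentSpace I x, MDiffAt (T% X) x ∧ X x = v :=
      ⟨extend E v, mdifferentiableAt_extend I E v, by simp⟩
    refine eq_of_forall_inner fun Z hZ ↦ ?_
    have hfY : MDiffAt (T% (f • Y)) x := hf.smul_section hY
    have h1 := mvfderiv_fun_mul hf (mdifferentiableAt_inner hY hZ)
    have h2 := mvfderiv_fun_mul hf (mdifferentiableAt_inner hX hY)
    rw [add_apply, inner_add_left, inner_leviCivitaFun hfY hX hZ,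
      smul_apply, inner_smul_left, inner_leviCivitaFun hY hX hZ]
    simp [koszul, inner_smul_left, inner_smul_right, h1, h2, inner_add_left,
      mlieBracket_smul_left hf hY, mlieBracket_smul_right hf hY]
    rw [real_inner_comm (Y x) (X x)]
    ring

variable (I M) in
/-- The Levi-Civita connection; `leviCivita I M Y x v` is `(∇_v Y)(x)`. -/
def leviCivita : CovariantDerivative I E (fun x : M ↦ TangentSpace I x) where
  toFun := leviCivitaFun
  isCovariantDerivativeOnUniv := isCovariantDerivativeOn_leviCivitaFun

/-- The Levi-Civita connection is torsion-free. -/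
theorem leviCivita_sub_swap {X Y : Π x : M, TangentSpace I x} {x : M}
    (hX : MDiffAt (T% X) x) (hY : MDiffAt (T% Y) x) :
    leviCivita I M Y x (X x) - leviCivita I M X x (Y x) = mlieBracket I X Y x := by
  refine eq_of_forall_inner fun Z hZ ↦ ?_
  change inner ℝ (leviCivitaFun Y x (X x) - leviCivitaFun X x (Y x)) (Z x) = _
  rw [inner_sub_left, inner_leviCivitaFun hY hX hZ, inner_leviCivitaFun hX hY hZ]
  have h := mlieBracket_swap_apply (I := I) (V := Y) (W := X) (x := x)
  simp only [koszul, h, inner_neg_left, real_inner_comm]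
  ring

/-- The Levi-Civita connection is compatible with the metric. -/
theorem mvfderiv_inner_eq {X Y Z : Π x : M, TangentSpace I x} {x : M}
    (hX : MDiffAt (T% X) x) (hY : MDiffAt (T% Y) x) (hZ : MDiffAt (T% Z) x) :
    mvfderiv I (fun y ↦ (inner ℝ (Y y) (Z y) : ℝ)) x (X x) =
      inner ℝ (leviCivita I M Y x (X x)) (Z x) + inner ℝ (Y x) (leviCivita I M Z x (X x)) := by
  change _ = inner ℝ (leviCivitaFun Y x (X x)) (Z x) + inner ℝ (Y x) (leviCivitaFun Z x (X x))
  rw [real_inner_comm (leviCivitaFun Z x (X x)), inner_leviCivitaFun hY hX hZ,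
    inner_leviCivitaFun hZ hX hY]
  have h := mlieBracket_swap_apply (I := I) (V := Z) (W := Y) (x := x)
  simp only [koszul, h, inner_neg_left, real_inner_comm]
  ring

end LeviCivita

section Tensors

variable {E : Type*} [NormedAddCommGroup E] [NormedSpace ℝ E] [FiniteDimensional ℝ E]
  {H : Type*} [TopologicalSpace H] {I : ModelWithCorners ℝ E H}
  {M : Type*} [TopologicalSpace M] [ChartedSpace H M] [IsManifold I ∞ M]
  [RiemannianBundle (fun x : M ↦ TangentSpace I x)]
  [IsContMDiffRiemannianBundle I ∞ E (fun x : M ↦ TangentSpace I x)]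

/-! Values of tensors at a point are computed with the help of the vector fields `extend E v`: such
a field is smooth near the base point `x` of `v` and has the value `v` at `x`. By tensoriality the
choice of the extension does not matter. -/

/-- The vector field `R_{X,Y} Z = ∇_X ∇_Y Z - ∇_Y ∇_X Z - ∇_{[X,Y]} Z`. -/
def curvature (X Y Z : Π x : M, TangentSpace I x) (x : M) : TangentSpace I x :=
  leviCivita I M (fun y ↦ leviCivita I M Z y (Y y)) x (X x)
    - leviCivita I M (fun y ↦ leviCivita I M Z y (X y)) x (Y x)
    - leviCivita I M Z x (mlieBracket I X Y x)

/-- The Riemannian curvature tensor `R_{uvwz} = ⟨R_{u,v} w, z⟩` at the point `x`. -/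
def riemann (x : M) (u v w z : TangentSpace I x) : ℝ :=
  inner ℝ (curvature (extend E u) (extend E v) (extend E w) x) z

/-- The covariant derivative of a 1-form: `covDerivOne α x v w` is `(∇_v α)(w)`. -/
def covDerivOne (α : Π x : M, TangentSpace I x → ℝ) (x : M) (v w : TangentSpace I x) : ℝ :=
  mvfderiv I (fun y ↦ α y (extend E w y)) x v - α x (leviCivita I M (extend E w) x v)

/-- The covariant derivative of a 2-tensor: `covDerivTwo β x u v w` is `(∇_u β)(v, w)`. -/
def covDerivTwo (β : Π x : M, TangentSpace I x → TangentSpace I x → ℝ) (x : M)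
    (u v w : TangentSpace I x) : ℝ :=
  mvfderiv I (fun y ↦ β y (extend E v y) (extend E w y)) x u
    - β x (leviCivita I M (extend E v) x u) w - β x v (leviCivita I M (extend E w) x u)

/-- The codifferential of a 1-form, `δα = -∑ᵢ (∇_{eᵢ} α)(eᵢ)`. -/
def codiffOne (α : Π x : M, TangentSpace I x → ℝ) (x : M) : ℝ :=
  -∑ i, covDerivOne α x (stdOrthonormalBasis ℝ (TangentSpace I x) i)
    (stdOrthonormalBasis ℝ (TangentSpace I x) i)

/-- The codifferential of a 2-form, `(δβ)(w) = -∑ᵢ (∇_{eᵢ} β)(eᵢ, w)`. -/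
def codiffTwo (β : Π x : M, TangentSpace I x → TangentSpace I x → ℝ) (x : M)
    (w : TangentSpace I x) : ℝ :=
  -∑ i, covDerivTwo β x (stdOrthonormalBasis ℝ (TangentSpace I x) i)
    (stdOrthonormalBasis ℝ (TangentSpace I x) i) w

/-- The squared pointwise norm `|α|² = ∑ᵢ α(eᵢ)²` of a 1-form. -/
def normSqOne (α : Π x : M, TangentSpace I x → ℝ) (x : M) : ℝ :=
  ∑ i, α x (stdOrthonormalBasis ℝ (TangentSpace I x) i) ^ 2

variable (J : Π x : M, TangentSpace I x →L[ℝ] TangentSpace I x)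

/-- The Nijenhuis tensor `N(A, B) = [JA, JB] - [A, B] - J[JA, B] - J[A, JB]`. -/
def nijenhuis (A B : Π x : M, TangentSpace I x) (x : M) : TangentSpace I x :=
  mlieBracket I (fun y ↦ J y (A y)) (fun y ↦ J y (B y)) x - mlieBracket I A B x
    - J x (mlieBracket I (fun y ↦ J y (A y)) B x) - J x (mlieBracket I A (fun y ↦ J y (B y)) x)

/-- `J` is a Hermitian structure on the Riemannian manifold `M`: a smooth almost complex structure
that is orthogonal for the metric and integrable (its Nijenhuis tensor vanishes). -/
structure IsHermitian : Prop where
  contMDiff : ContMDiff I (I.prod 𝓘(ℝ, E →L[ℝ] E)) ∞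
    (fun x ↦ TotalSpace.mk' (E →L[ℝ] E) (E := fun x : M ↦ TangentSpace I x →L[ℝ] TangentSpace I x)
      x (J x))
  sq (x : M) (v : TangentSpace I x) : J x (J x v) = -v
  orthogonal (x : M) (v w : TangentSpace I x) : (inner ℝ (J x v) (J x w) : ℝ) = inner ℝ v w
  integrable (A B : Π x : M, TangentSpace I x) (x : M) (hA : MDiffAt (T% A) x)
    (hB : MDiffAt (T% B) x) : nijenhuis J A B x = 0

/-- The fundamental 2-form `ω(v, w) = ⟨Jv, w⟩`. -/
def fundamentalForm (x : M) (v w : TangentSpace I x) : ℝ :=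
  inner ℝ (J x v) w

/-- The action of `J` on 1-forms, `(Jα)(v) = -α(Jv)`. -/
def actOne (α : Π x : M, TangentSpace I x → ℝ) (x : M) (v : TangentSpace I x) : ℝ :=
  -α x (J x v)

/-- The Lee form `θ = J δω` of an almost Hermitian structure in real dimension four. -/
def leeForm : Π x : M, TangentSpace I x → ℝ :=
  actOne J (codiffTwo (fundamentalForm J))

/-- The `J`-anti-invariant part `β''(v, w) = (β(v, w) - β(Jv, Jw)) / 2` of a 2-tensor. -/
def antiInvariantPart (β : Π x : M, TangentSpace I x → TangentSpace I x → ℝ) (x : M)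
    (v w : TangentSpace I x) : ℝ :=
  (β x v w - β x (J x v) (J x w)) / 2

/-- Gray's first curvature condition, `R_{uvwz} = R_{uv(Jw)(Jz)}`. -/
def GrayFirst : Prop :=
  ∀ (x : M) (u v w z : TangentSpace I x), riemann x u v w z = riemann x u v (J x w) (J x z)

end Tensors

end HermitianSurface

end

/-!
Let `T` be the vector field dual to the Lee form, and let `(u ∧ T) v = ⟨u, v⟩ T - ⟨T, v⟩ u`. On a
Hermitian surface `2 ∇_u J = [J, u ∧ T]`, so that the metric connection `D_u = ∇_u + (u ∧ T) / 2`
preserves `J`. The curvature of `D` is `R_{u,v} - (u ∧ S v - v ∧ S u)` with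
`S = ∇T / 2 + T ⊗ T / 4 - |T|² / 8`, and it commutes with `J`; hence
`[J, R_{u,v}] = [J, u ∧ S v - v ∧ S u]`. Gray's condition says that the left-hand side vanishes. If
it does, contracting the right-hand side gives `tr S = 0` and `[J, S] = 0`. If conversely `tr S = 0`
and `[J, S] = 0`, then the right-hand side is determined by the numbers `⟨[J, R_{u,v}] u, v⟩`, and
the pair symmetry of `R` makes these vanish. The two conditions on `S` are the two equations for the
Lee form.
-/

noncomputable section

namespace HermitianSurface

open Filter InnerProductSpace Topology
open LinearMap (trace)

attribute [local instance] LieRing.ofAssociativeRing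

/-! ### Orthogonal complex structures on Euclidean vector spaces -/

section LinearAlgebra

variable {V : Type*} [NormedAddCommGroup V] [InnerProductSpace ℝ V]

/-- An orthogonal complex structure on a Euclidean vector space: the fibrewise content of an
almost Hermitian structure. -/
structure IsOrthogonalComplex (J : Module.End ℝ V) : Prop where
  map_map (v : V) : J (J v) = -v
  inner_map_map (v w : V) : inner ℝ (J v) (J w) = inner ℝ v w

theorem exists_norm_eq_one_inner_eq_zero (hV : 2 < Module.finrank ℝ V) (v w : V) :
    ∃ f : V, ‖f‖ = 1 ∧ (inner ℝ v f : ℝ) = 0 ∧ (inner ℝ w f : ℝ) = 0 := by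
  have : FiniteDimensional ℝ V := .of_finrank_pos (by omega)
  let W : Submodule ℝ V := Submodule.span ℝ (Set.range ![v, w])
  have hW : Module.finrank ℝ W ≤ 2 := (finrank_range_le_card ![v, w]).trans (by simp)
  have : Nontrivial Wᗮ := Module.nontrivial_of_finrank_pos (R := ℝ)
    (by have := W.finrank_add_finrank_orthogonal; omega)
  obtain ⟨⟨f, hf⟩, hf1⟩ := exists_norm_eq Wᗮ (zero_le_one (α := ℝ))
  rw [Submodule.mem_orthogonal] at hf
  exact ⟨f, hf1, hf v (Submodule.subset_span ⟨0, rfl⟩), hf w (Submodule.subset_span ⟨1, rfl⟩)⟩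

theorem inner_self_eq_zero_of_skew {A : Module.End ℝ V}
    (hA : ∀ v w, (inner ℝ (A v) w : ℝ) = -inner ℝ v (A w)) (v : V) :
    (inner ℝ (A v) v : ℝ) = 0 := by
  linarith [hA v v, real_inner_comm v (A v)]

theorem eq_zero_of_symm_of_skew {P : V → V → V} (hsymm : ∀ u v, P u v = P v u)
    (hskew : ∀ u v w, (inner ℝ (P u v) w : ℝ) = -inner ℝ v (P u w)) (u v : V) : P u v = 0 := by
  refine ext_inner_right ℝ fun w ↦ ?_
  rw [inner_zero_left]
  have huvw := hskew u v w
  have hvwu := hskew v w u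
  have hwuv := hskew w u v
  rw [hsymm u w, real_inner_comm] at huvw
  rw [hsymm v u, real_inner_comm] at hvwu
  rw [hsymm w v, real_inner_comm] at hwuv
  linarith [real_inner_comm (P u v) w, real_inner_comm (P w u) v, real_inner_comm (P v w) u]

/-- The skew endomorphism `a ∧ b` given by `(a ∧ b) v = ⟨a, v⟩ b - ⟨b, v⟩ a`. -/
def wedge : V →ₗ[ℝ] V →ₗ[ℝ] Module.End ℝ V :=
  let A : V →ₗ[ℝ] V →ₗ[ℝ] Module.End ℝ V := LinearMap.smulRightₗ ∘ₗ innerₗ V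
  A - A.flip

theorem wedge_apply (a b v : V) :
    wedge a b v = (inner ℝ a v : ℝ) • b - (inner ℝ b v : ℝ) • a :=
  rfl

theorem inner_wedge_left (a b v w : V) :
    (inner ℝ (wedge a b v) w : ℝ) = -inner ℝ v (wedge a b w) := by
  simp only [wedge_apply, inner_sub_left, inner_sub_right, real_inner_smul_left,
    real_inner_smul_right, real_inner_comm v]
  ring

theorem lie_wedge {A : Module.End ℝ V} (hA : ∀ v w, (inner ℝ (A v) w : ℝ) = -inner ℝ v (A w))
    (a b : V) : ⁅A, wedge a b⁆ = wedge (A a) b + wedge a (A b) := by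
  ext v
  simp only [Ring.lie_def, LinearMap.sub_apply, Module.End.mul_apply, LinearMap.add_apply,
    wedge_apply, map_sub, map_smul, hA]
  module

/-- The Kulkarni–Nomizu product `g ∧ S` of the metric and an endomorphism `S`, as a 2-form with
values in the skew endomorphisms. -/
def metricWedge (S : Module.End ℝ V) : V →ₗ[ℝ] V →ₗ[ℝ] Module.End ℝ V :=
  wedge.compl₂ S - (wedge.compl₂ S).flip

theorem metricWedge_apply (S : Module.End ℝ V) (u v : V) :
    metricWedge S u v = wedge u (S v) - wedge v (S u) :=
  rfl

theorem metricWedge_self (S : Module.End ℝ V) (u : V) : metricWedge S u u = 0 :=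
  sub_self _

theorem metricWedge_swap (S : Module.End ℝ V) (u v : V) :
    metricWedge S v u = -metricWedge S u v :=
  (neg_sub _ _).symm

theorem inner_metricWedge_left (S : Module.End ℝ V) (u v x y : V) :
    (inner ℝ (metricWedge S u v x) y : ℝ) = -inner ℝ x (metricWedge S u v y) := by
  simp only [metricWedge_apply, LinearMap.sub_apply, inner_sub_left, inner_sub_right,
    inner_wedge_left]
  ring

namespace IsOrthogonalComplex

variable {J : Module.End ℝ V}

theorem inner_map_left (hJ : IsOrthogonalComplex J) (v w : V) :
    (inner ℝ (J v) w : ℝ) = -inner ℝ v (J w) := by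
  rw [← hJ.inner_map_map v (J w), hJ.map_map, inner_neg_right, neg_neg]

theorem inner_map_self (hJ : IsOrthogonalComplex J) (v : V) : (inner ℝ (J v) v : ℝ) = 0 := by
  linarith [hJ.inner_map_left v v, real_inner_comm v (J v)]

theorem inner_self_map (hJ : IsOrthogonalComplex J) (v : V) : (inner ℝ v (J v) : ℝ) = 0 := by
  rw [real_inner_comm, hJ.inner_map_self]

theorem norm_map (hJ : IsOrthogonalComplex J) (v : V) : ‖J v‖ = ‖v‖ := by
  rw [norm_eq_sqrt_real_inner, hJ.inner_map_map, ← norm_eq_sqrt_real_inner]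

theorem orthonormal_adapted (hJ : IsOrthogonalComplex J) {e f : V} (he : ‖e‖ = 1) (hf : ‖f‖ = 1)
    (hef : (inner ℝ e f : ℝ) = 0) (hJef : (inner ℝ (J e) f : ℝ) = 0) :
    Orthonormal ℝ ![e, J e, f, J f] := by
  have heJf : (inner ℝ e (J f) : ℝ) = 0 := by linarith [hJ.inner_map_left e f]
  rw [orthonormal_iff_ite]
  intro i j
  fin_cases i <;> fin_cases j <;>
    simp [hJ.inner_map_map, hJ.inner_map_self, hJ.inner_self_map, hJ.norm_map, he, hf, hef, hJef,
      heJf, real_inner_comm e, real_inner_comm (J e)]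

theorem exists_adapted_orthonormalBasis (hJ : IsOrthogonalComplex J)
    (hV : Module.finrank ℝ V = 4) {e : V} (he : ‖e‖ = 1) :
    ∃ b : OrthonormalBasis (Fin 4) ℝ V, b 0 = e ∧ b 1 = J e ∧ b 3 = J (b 2) := by
  obtain ⟨f, hf, hef, hJef⟩ := exists_norm_eq_one_inner_eq_zero (by omega) e (J e)
  have hon := hJ.orthonormal_adapted he hf hef hJef
  exact ⟨.mk hon (hon.linearIndependent.span_eq_top_of_card_eq_finrank (by simp [hV])).ge, by simp⟩

theorem inner_map_eq_zero_of_skew_of_anticomm (hJ : IsOrthogonalComplex J) {A : Module.End ℝ V}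
    (hskew : ∀ v w, (inner ℝ (A v) w : ℝ) = -inner ℝ v (A w)) (hanti : ∀ v, A (J v) = -J (A v))
    (v : V) : (inner ℝ (A v) (J v) : ℝ) = 0 := by
  have h := hskew v (J v)
  rw [hanti, inner_neg_right, neg_neg, ← neg_eq_iff_eq_neg.2 (hJ.inner_map_left v (A v)),
    real_inner_comm] at h
  rw [real_inner_comm]
  linarith

theorem eq_zero_of_map_eq_zero (hJ : IsOrthogonalComplex J) (hV : Module.finrank ℝ V = 4)
    {A : Module.End ℝ V} (hskew : ∀ v w, (inner ℝ (A v) w : ℝ) = -inner ℝ v (A w))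
    (hanti : ∀ v, A (J v) = -J (A v)) {e : V} (he : ‖e‖ = 1) (hAe : A e = 0) : A = 0 := by
  obtain ⟨b, h0, h1, h3⟩ := hJ.exists_adapted_orthonormalBasis hV he
  have hAJe : A (J e) = 0 := by rw [hanti, hAe, map_zero, neg_zero]
  have hA2 : A (b 2) = 0 := by
    refine InnerProductSpace.ext_inner_right_basis b.toBasis fun i ↦ ?_
    fin_cases i
    · simp [hskew, h0, hAe]
    · simp [hskew, h1, hAJe]
    · simp [inner_self_eq_zero_of_skew hskew]
    · simp [h3, hJ.inner_map_eq_zero_of_skew_of_anticomm hskew hanti]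
  refine b.toBasis.ext fun i ↦ ?_
  fin_cases i <;> simp [h0, h1, h3, hAe, hAJe, hanti, hA2]

theorem map_self_eq_zero_of_sum_map_self_eq_zero (hJ : IsOrthogonalComplex J)
    {D : V →ₗ[ℝ] Module.End ℝ V} (hskew : ∀ u v w, (inner ℝ (D u v) w : ℝ) = -inner ℝ v (D u w))
    (hanti : ∀ u v, D u (J v) = -J (D u v)) (hint : ∀ u v, D (J u) v = J (D u v))
    {b : OrthonormalBasis (Fin 4) ℝ V} (h1 : b 1 = J (b 0)) (h3 : b 3 = J (b 2))
    (hb : ∑ i, D (b i) (b i) = 0) : D (b 0) (b 0) = 0 := by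
  have hJJ (u : V) : D (J u) (J u) = D u u := by rw [hint, hanti, map_neg, hJ.map_map, neg_neg]
  have hsum : D (b 0) (b 0) = -D (b 2) (b 2) := by
    simp only [Fin.sum_univ_four, h1, h3, hJJ] at hb
    linear_combination (norm := module) (2⁻¹ : ℝ) • hb
  have hself (u v : V) := inner_self_eq_zero_of_skew (hskew u) v
  have hmap (u v : V) := hJ.inner_map_eq_zero_of_skew_of_anticomm (hskew u) (hanti u) v
  refine InnerProductSpace.ext_inner_right_basis b.toBasis fun i ↦ ?_
  fin_cases i
  · simp [hself]
  · simp [h1, hmap]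
  · simp [hsum, hself]
  · simp [hsum, h3, hmap]

theorem eq_zero_of_trace_flip_eq_zero (hJ : IsOrthogonalComplex J) (hV : Module.finrank ℝ V = 4)
    {D : V →ₗ[ℝ] Module.End ℝ V} (hskew : ∀ u v w, (inner ℝ (D u v) w : ℝ) = -inner ℝ v (D u w))
    (hanti : ∀ u v, D u (J v) = -J (D u v)) (hint : ∀ u v, D (J u) v = J (D u v))
    (htr : ∀ w, trace ℝ V (D.flip w) = 0) : D = 0 := by
  have hunit {e : V} (he : ‖e‖ = 1) : D e = 0 := by
    obtain ⟨b, h0, h1, h3⟩ := hJ.exists_adapted_orthonormalBasis hV he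
    have hb : ∑ i, D (b i) (b i) = 0 := ext_inner_right ℝ fun w ↦ by
      simpa [LinearMap.trace_eq_sum_inner _ b, sum_inner, hskew] using htr w
    refine hJ.eq_zero_of_map_eq_zero hV (hskew e) (hanti e) he ?_
    rw [← h0] at h1 ⊢
    exact hJ.map_self_eq_zero_of_sum_map_self_eq_zero hskew hanti hint h1 h3 hb
  have : FiniteDimensional ℝ V := .of_finrank_pos (by omega)
  exact (stdOrthonormalBasis ℝ V).toBasis.ext fun i ↦ by simp [hunit]

theorem lie_wedge_apply (hJ : IsOrthogonalComplex J) (a b v : V) : ⁅J, wedge a b⁆ v =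
    (inner ℝ (J a) v : ℝ) • b - (inner ℝ b v : ℝ) • J a
      + ((inner ℝ a v : ℝ) • J b - (inner ℝ (J b) v : ℝ) • a) := by
  rw [lie_wedge hJ.inner_map_left, LinearMap.add_apply, wedge_apply, wedge_apply]

theorem lie_wedge_map_left (hJ : IsOrthogonalComplex J) (a b : V) :
    ⁅J, wedge (J a) b⁆ = J * ⁅J, wedge a b⁆ := by
  ext v
  simp only [Module.End.mul_apply, hJ.lie_wedge_apply, map_add, map_sub, map_smul, hJ.map_map,
    inner_neg_left]
  module

theorem lie_wedge_map_right (hJ : IsOrthogonalComplex J) (a b : V) :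
    ⁅J, wedge a (J b)⁆ = J * ⁅J, wedge a b⁆ := by
  ext v
  simp only [Module.End.mul_apply, hJ.lie_wedge_apply, map_add, map_sub, map_smul, hJ.map_map,
    inner_neg_left]
  module

theorem inner_lie_left (hJ : IsOrthogonalComplex J) {A : Module.End ℝ V}
    (hskew : ∀ v w, (inner ℝ (A v) w : ℝ) = -inner ℝ v (A w)) (v w : V) :
    (inner ℝ (⁅J, A⁆ v) w : ℝ) = -inner ℝ v (⁅J, A⁆ w) := by
  simp only [Ring.lie_def, LinearMap.sub_apply, Module.End.mul_apply, inner_sub_left,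
    inner_sub_right, hJ.inner_map_left, hskew]
  ring

theorem lie_map (hJ : IsOrthogonalComplex J) (A : Module.End ℝ V) (v : V) :
    ⁅J, A⁆ (J v) = -J (⁅J, A⁆ v) := by
  simp [Ring.lie_def, hJ.map_map]

theorem trace_lie_wedge [FiniteDimensional ℝ V] (hJ : IsOrthogonalComplex J) (T w : V) :
    trace ℝ V ((LieAlgebra.ad ℝ (Module.End ℝ V) J ∘ₗ wedge.flip T).flip w) =
      (2 - Module.finrank ℝ V) * inner ℝ (J T) w := by
  let e := stdOrthonormalBasis ℝ V
  have h (i) : (inner ℝ (e i) (⁅J, wedge (e i) T⁆ w) : ℝ) =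
      inner ℝ (J T) (e i) * inner ℝ (e i) w - inner ℝ T (e i) * inner ℝ (e i) (J w)
        - inner ℝ (J T) w := by
    simp only [hJ.lie_wedge_apply, inner_add_right, inner_sub_right, real_inner_smul_right,
      hJ.inner_self_map, real_inner_self_eq_norm_sq, e.norm_eq_one, hJ.inner_map_left (e i),
      real_inner_comm (e i) T, real_inner_comm (e i) (J T)]
    ring
  rw [LinearMap.trace_eq_sum_inner _ e]
  simp only [LinearMap.flip_apply, LinearMap.comp_apply, LieAlgebra.ad_apply, h,
    Finset.sum_sub_distrib, e.sum_inner_mul_inner, hJ.inner_map_left T w, Finset.sum_const,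
    Finset.card_univ, Fintype.card_fin, nsmul_eq_mul]
  ring

theorem two_smul_eq_lie_wedge (hJ : IsOrthogonalComplex J) (hV : Module.finrank ℝ V = 4)
    {D : V →ₗ[ℝ] Module.End ℝ V} (hskew : ∀ u v w, (inner ℝ (D u v) w : ℝ) = -inner ℝ v (D u w))
    (hanti : ∀ u v, D u (J v) = -J (D u v)) (hint : ∀ u v, D (J u) v = J (D u v))
    {T : V} (hT : ∀ w, trace ℝ V (D.flip w) = -inner ℝ (J T) w) (u : V) :
    (2 : ℝ) • D u = ⁅J, wedge u T⁆ := by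
  have : FiniteDimensional ℝ V := .of_finrank_pos (by omega)
  let L := LieAlgebra.ad ℝ (Module.End ℝ V) J ∘ₗ wedge.flip T
  have hL (u v : V) : ((2 : ℝ) • D - L) u v = (2 : ℝ) • D u v - ⁅J, wedge u T⁆ v := rfl
  suffices (2 : ℝ) • D - L = 0 from congr($(sub_eq_zero.1 this) u)
  refine hJ.eq_zero_of_trace_flip_eq_zero hV (fun u v w ↦ ?_) (fun u v ↦ ?_) (fun u v ↦ ?_)
    fun w ↦ ?_
  · simp only [hL, inner_sub_left, inner_sub_right, real_inner_smul_left, real_inner_smul_right,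
      hskew, hJ.inner_lie_left (inner_wedge_left u T)]
    ring
  · simp only [hL, hanti, hJ.lie_map, map_sub, map_smul]
    module
  · simp only [hL, hint, hJ.lie_wedge_map_left, Module.End.mul_apply, map_sub, map_smul]
  · have hflip : ((2 : ℝ) • D - L).flip w = (2 : ℝ) • D.flip w - L.flip w :=
      LinearMap.ext fun _ ↦ rfl
    rw [hflip, map_sub, map_smul, hT, hJ.trace_lie_wedge, hV, smul_eq_mul]
    ring

theorem sum_lie_metricWedge [FiniteDimensional ℝ V] (hJ : IsOrthogonalComplex J)
    (S : Module.End ℝ V) {ι : Type*} [Fintype ι] (e : OrthonormalBasis ι ℝ V) (v : V) :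
    ∑ i, ⁅J, metricWedge S (e i) v⁆ (e i) =
      (Module.finrank ℝ V - 3 : ℝ) • J (S v) - S (J v) + trace ℝ V S • J v
        + trace ℝ V (J * S) • v := by
  have h (i : ι) : ⁅J, metricWedge S (e i) v⁆ (e i) = J (S v)
      - J ((inner ℝ (e i) (S v) : ℝ) • e i) - (inner ℝ (e i) (J (S v)) : ℝ) • e i
      - S ((inner ℝ (e i) (J v) : ℝ) • e i) + (inner ℝ (e i) (S (e i)) : ℝ) • J v
      - J (S ((inner ℝ (e i) v : ℝ) • e i)) + (inner ℝ (e i) (J (S (e i))) : ℝ) • v := by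
    simp only [metricWedge_apply, lie_sub, LinearMap.sub_apply, hJ.lie_wedge_apply,
      hJ.inner_map_self, real_inner_self_eq_norm_sq, e.norm_eq_one, map_smul, real_inner_comm (e i)]
    module
  simp only [h, Finset.sum_add_distrib, Finset.sum_sub_distrib, ← map_sum, ← Finset.sum_smul,
    e.sum_repr', LinearMap.trace_eq_sum_inner _ e, Module.finrank_eq_card_basis e.toBasis,
    Finset.sum_const, Finset.card_univ, Module.End.mul_apply, ← Nat.cast_smul_eq_nsmul ℝ]
  simp only [map_smul]
  module

theorem comm_of_lie_metricWedge_eq_zero (hJ : IsOrthogonalComplex J)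
    (hV : Module.finrank ℝ V = 4) {S : Module.End ℝ V}
    (h : ∀ u v, ⁅J, metricWedge S u v⁆ = 0) : trace ℝ V S = 0 ∧ Commute J S := by
  have : FiniteDimensional ℝ V := .of_finrank_pos (by omega)
  have : Nontrivial V := Module.nontrivial_of_finrank_pos (R := ℝ) (by omega)
  have hsum (v : V) : J (S v) - S (J v) + trace ℝ V S • J v + trace ℝ V (J * S) • v = 0 := by
    have := hJ.sum_lie_metricWedge S (stdOrthonormalBasis ℝ V) v
    simp only [h, hV, LinearMap.zero_apply, Finset.sum_const_zero] at this
    rw [this]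
    module
  obtain ⟨e, he⟩ := exists_norm_eq V (zero_le_one (α := ℝ))
  have htr : (2 : ℝ) • (trace ℝ V (J * S) • J e - trace ℝ V S • e) = 0 := by
    have h1 := congr(J $(hsum e) + $(hsum (J e)))
    simp only [map_add, map_sub, map_smul, hJ.map_map, map_zero, map_neg, add_zero] at h1
    rw [← h1]
    module
  have h2 := (smul_eq_zero.1 htr).resolve_left two_ne_zero
  have hS : trace ℝ V S = 0 := by
    simpa [inner_sub_right, real_inner_smul_right, hJ.inner_self_map, he] using
      congr((inner ℝ e $h2 : ℝ))
  have hJS : trace ℝ V (J * S) = 0 := by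
    simpa [inner_sub_right, real_inner_smul_right, hJ.inner_map_self, hJ.norm_map, he] using
      congr((inner ℝ (J e) $h2 : ℝ))
  refine ⟨hS, LinearMap.ext fun v ↦ sub_eq_zero.1 ?_⟩
  simpa [hS, hJS] using hsum v

theorem lie_metricWedge_map_left (hJ : IsOrthogonalComplex J) {S : Module.End ℝ V}
    (hS : Commute J S) (u v : V) :
    ⁅J, metricWedge S (J u) v⁆ = J * ⁅J, metricWedge S u v⁆ := by
  have h : S (J u) = J (S u) := congr($hS.symm.eq u)
  simp only [metricWedge_apply, lie_sub, mul_sub, h, hJ.lie_wedge_map_left, hJ.lie_wedge_map_right]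

theorem lie_metricWedge_map_right (hJ : IsOrthogonalComplex J) {S : Module.End ℝ V}
    (hS : Commute J S) (u v : V) :
    ⁅J, metricWedge S u (J v)⁆ = J * ⁅J, metricWedge S u v⁆ := by
  rw [metricWedge_swap, lie_neg, hJ.lie_metricWedge_map_left hS, metricWedge_swap S u, lie_neg,
    mul_neg, neg_neg]

theorem inner_lie_add_eq_zero_of_pair_symm (hJ : IsOrthogonalComplex J)
    {R : V → V → Module.End ℝ V}
    (hR : ∀ u v w z, (inner ℝ (R u v w) z : ℝ) = inner ℝ (R w z u) v) (u v : V) :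
    (inner ℝ (⁅J, R u v⁆ u) v - inner ℝ (⁅J, R (J u) (J v)⁆ u) v
      + inner ℝ (⁅J, R u (J v)⁆ u) (J v) + inner ℝ (⁅J, R (J u) v⁆ u) (J v) : ℝ) = 0 := by
  simp only [Ring.lie_def, LinearMap.sub_apply, Module.End.mul_apply, inner_sub_left,
    hJ.inner_map_left, hJ.map_map, inner_neg_right]
  linarith [hR u v u (J v), hR u v (J u) v, hR (J u) (J v) u (J v), hR (J u) (J v) (J u) v]

theorem inner_lie_metricWedge_map (hJ : IsOrthogonalComplex J) (S : Module.End ℝ V) {u v : V}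
    (hu : ‖u‖ = 1) (hv : ‖v‖ = 1) (huv : (inner ℝ u v : ℝ) = 0) (hJuv : (inner ℝ (J u) v : ℝ) = 0) :
    (inner ℝ (⁅J, metricWedge S u v⁆ u) (J v) : ℝ) = inner ℝ u (S u) + inner ℝ v (S v) := by
  have huJv : (inner ℝ u (J v) : ℝ) = 0 := by linarith [hJ.inner_map_left u v]
  have hvu : (inner ℝ v u : ℝ) = 0 := by rw [real_inner_comm, huv]
  have hJvu : (inner ℝ (J v) u : ℝ) = 0 := by rw [real_inner_comm, huJv]
  simp only [metricWedge_apply, lie_sub, LinearMap.sub_apply, hJ.lie_wedge_apply, inner_sub_left,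
    inner_add_left, real_inner_smul_left, hJ.inner_map_map, hJ.inner_map_self, hJ.inner_self_map,
    real_inner_self_eq_norm_sq, hu, hv, huv, hvu, huJv, hJvu, real_inner_comm _ (S _)]
  ring

theorem lie_metricWedge_adapted_eq_zero (hJ : IsOrthogonalComplex J)
    (hV : Module.finrank ℝ V = 4) {S : Module.End ℝ V} (htr : trace ℝ V S = 0) (hS : Commute J S)
    (h : ∀ u v, (inner ℝ (⁅J, metricWedge S u v⁆ u) v : ℝ) = 0)
    {b : OrthonormalBasis (Fin 4) ℝ V} (h1 : b 1 = J (b 0)) (h3 : b 3 = J (b 2)) :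
    ⁅J, metricWedge S (b 0) (b 2)⁆ = 0 := by
  have hb (i j : Fin 4) (hij : i ≠ j) : (inner ℝ (b i) (b j) : ℝ) = 0 := b.orthonormal.2 hij
  have hskew := hJ.inner_lie_left (inner_metricWedge_left S (b 0) (b 2))
  have hmap (i) : (inner ℝ (J (b i)) (S (J (b i))) : ℝ) = inner ℝ (b i) (S (b i)) := by
    rw [← Module.End.mul_apply S, ← hS.eq, Module.End.mul_apply, hJ.inner_map_map]
  have htr' : (inner ℝ (b 0) (S (b 0)) + inner ℝ (b 2) (S (b 2)) : ℝ) = 0 := by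
    rw [LinearMap.trace_eq_sum_inner _ b, Fin.sum_univ_four, h1, h3, hmap, hmap] at htr
    linarith
  refine hJ.eq_zero_of_map_eq_zero hV hskew (hJ.lie_map _) (b.norm_eq_one 0)
    (InnerProductSpace.ext_inner_right_basis b.toBasis fun i ↦ ?_)
  fin_cases i
  · simpa using inner_self_eq_zero_of_skew hskew (b 0)
  · simpa [h1] using hJ.inner_map_eq_zero_of_skew_of_anticomm hskew (hJ.lie_map _) (b 0)
  · simpa using h (b 0) (b 2)
  · simpa [h3, htr'] using hJ.inner_lie_metricWedge_map S (b.norm_eq_one 0) (b.norm_eq_one 2)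
      (hb 0 2 (by decide)) (by rw [← h1, hb 1 2 (by decide)])

theorem lie_metricWedge_eq_zero (hJ : IsOrthogonalComplex J) (hV : Module.finrank ℝ V = 4)
    {S : Module.End ℝ V} (htr : trace ℝ V S = 0) (hS : Commute J S)
    (h : ∀ u v, (inner ℝ (⁅J, metricWedge S u v⁆ u) v : ℝ) = 0) (u v : V) :
    ⁅J, metricWedge S u v⁆ = 0 := by
  have : Nontrivial V := Module.nontrivial_of_finrank_pos (R := ℝ) (by omega)
  obtain ⟨e, he⟩ := exists_norm_eq V (zero_le_one (α := ℝ))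
  obtain ⟨b, rfl, h1, h3⟩ := hJ.exists_adapted_orthonormalBasis hV he
  have h02 := hJ.lie_metricWedge_adapted_eq_zero hV htr hS h h1 h3
  have h20 : ⁅J, metricWedge S (b 2) (b 0)⁆ = 0 := by
    rw [metricWedge_swap, lie_neg, h02, neg_zero]
  suffices (metricWedge S).compr₂ (LieAlgebra.ad ℝ (Module.End ℝ V) J) = 0 from
    congr($this u v)
  refine b.toBasis.ext fun i ↦ b.toBasis.ext fun j ↦ ?_
  fin_cases i <;> fin_cases j <;>
    simp [h1, h3, hJ.lie_metricWedge_map_left hS, hJ.lie_metricWedge_map_right hS, h02, h20,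
      metricWedge_self]

theorem forall_lie_eq_zero_iff (hJ : IsOrthogonalComplex J) (hV : Module.finrank ℝ V = 4)
    {R : V → V → Module.End ℝ V}
    (hR : ∀ u v w z, (inner ℝ (R u v w) z : ℝ) = inner ℝ (R w z u) v) {S : Module.End ℝ V}
    (hRS : ∀ u v, ⁅J, R u v⁆ = ⁅J, metricWedge S u v⁆) :
    (∀ u v, ⁅J, R u v⁆ = 0) ↔ trace ℝ V S = 0 ∧ Commute J S := by
  simp only [hRS]
  refine ⟨hJ.comm_of_lie_metricWedge_eq_zero hV, fun ⟨htr, hS⟩ ↦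
    hJ.lie_metricWedge_eq_zero hV htr hS fun u v ↦ ?_⟩
  have h := hJ.inner_lie_add_eq_zero_of_pair_symm hR u v
  simp only [hRS, hJ.lie_metricWedge_map_left hS, hJ.lie_metricWedge_map_right hS,
    Module.End.mul_apply, hJ.inner_map_map, hJ.map_map, inner_neg_left] at h
  linarith

theorem commute_iff_inner_map_map (hJ : IsOrthogonalComplex J) {A : Module.End ℝ V} :
    Commute J A ↔ ∀ v w, (inner ℝ (A v) w : ℝ) = inner ℝ (A (J v)) (J w) := by
  refine ⟨fun h v w ↦ ?_, fun h ↦ LinearMap.ext fun v ↦ ext_inner_right ℝ fun w ↦ ?_⟩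
  · rw [← Module.End.mul_apply, ← h.eq, Module.End.mul_apply, hJ.inner_map_map]
  · rw [Module.End.mul_apply, Module.End.mul_apply, hJ.inner_map_left, h, hJ.map_map,
      inner_neg_right, neg_neg]

end IsOrthogonalComplex

end LinearAlgebra

/-! ### Smooth functions and vector fields -/

section VectorFields

variable {E : Type*} [NormedAddCommGroup E] [NormedSpace ℝ E]
  {H : Type*} [TopologicalSpace H] {I : ModelWithCorners ℝ E H}
  {M : Type*} [TopologicalSpace M] [ChartedSpace H M]
  {x : M} {f g : M → ℝ} {X Y Z : Π y : M, TangentSpace I y}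

theorem mvfderiv_congr_of_eventuallyEq (h : f =ᶠ[𝓝 x] g) : mvfderiv I f x = mvfderiv I g x := by
  have := h.mfderiv_eq (I := I) (I' := 𝓘(ℝ, ℝ))
  ext w
  exact congr($this w)

variable [IsManifold I ∞ M]

theorem eventually_mdifferentiableAt {E' : Type*} [NormedAddCommGroup E'] [NormedSpace ℝ E']
    {H' : Type*} [TopologicalSpace H'] {I' : ModelWithCorners ℝ E' H'}
    {M' : Type*} [TopologicalSpace M'] [ChartedSpace H' M'] [IsManifold I' ∞ M'] {f : M → M'}
    (hf : CMDiffAt ∞ f x) : ∀ᶠ y in 𝓝 x, MDiffAt f y := by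
  have : IsManifold I 1 M := .of_le (n := ∞) (by simp)
  have : IsManifold I' 1 M' := .of_le (n := ∞) (by simp)
  have hf₁ : CMDiffAt 1 f x := hf.of_le (by simp)
  filter_upwards [(contMDiffAt_iff_contMDiffAt_nhds (by simp)).1 hf₁] with y hy
  exact hy.mdifferentiableAt one_ne_zero

theorem contMDiffAt_mvfderiv_apply (hf : CMDiffAt ∞ f x) (hX : CMDiffAt ∞ (T% X) x) :
    CMDiffAt ∞ (fun y ↦ mvfderiv I f y (X y)) x := by
  have := ContMDiffAt.clm_apply_of_inCoordinates (hf.mfderiv_const (m := ∞) (by simp)) hX hf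
  exact (contMDiff_snd_tangentBundle_modelSpace ℝ 𝓘(ℝ, ℝ)).contMDiffAt.comp x this

variable [CompleteSpace E]

theorem contMDiffAt_mlieBracket (hX : CMDiffAt ∞ (T% X) x) (hY : CMDiffAt ∞ (T% Y) x) :
    CMDiffAt ∞ (T% (mlieBracket I X Y)) x := by
  have : IsManifold I (minSmoothness ℝ 2) M :=
    .of_le (n := ∞) (by rw [minSmoothness_of_isRCLikeNormedField]; norm_cast)
  have : IsManifold I (∞ + 1) M := inferInstanceAs (IsManifold I ∞ M)
  exact ContMDiffAt.mlieBracket_vectorField (m := ⊤) (n := ⊤) hX hY (by simp)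

theorem mlieBracket_mlieBracket (hX : CMDiffAt ∞ (T% X) x) (hY : CMDiffAt ∞ (T% Y) x)
    (hZ : CMDiffAt ∞ (T% Z) x) :
    mlieBracket I X (mlieBracket I Y Z) x =
      mlieBracket I (mlieBracket I X Y) Z x + mlieBracket I Y (mlieBracket I X Z) x := by
  have : IsManifold I (minSmoothness ℝ 3) M :=
    .of_le (n := ∞) (by rw [minSmoothness_of_isRCLikeNormedField]; norm_cast)
  have hle : minSmoothness ℝ 2 ≤ ∞ := by rw [minSmoothness_of_isRCLikeNormedField]; norm_cast
  exact leibniz_identity_mlieBracket_apply (hX.of_le hle) (hY.of_le hle) (hZ.of_le hle)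

theorem mlieBracket_mlieBracket_smul (hY : CMDiffAt ∞ (T% Y) x)
    (hZ : CMDiffAt ∞ (T% Z) x) (hf : CMDiffAt ∞ f x) :
    mlieBracket I X (mlieBracket I Y (f • Z)) x =
      mvfderiv I (fun y ↦ mvfderiv I f y (Y y)) x (X x) • Z x
        + mvfderiv I f x (Y x) • mlieBracket I X Z x
        + (mvfderiv I f x (X x) • mlieBracket I Y Z x
          + f x • mlieBracket I X (mlieBracket I Y Z) x) := by
  have hYf := (contMDiffAt_mvfderiv_apply hf hY).mdifferentiableAt (by simp)
  have hYZ := (contMDiffAt_mlieBracket hY hZ).mdifferentiableAt (by simp)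
  have hf' := hf.mdifferentiableAt (by simp)
  have hZ' := hZ.mdifferentiableAt (by simp)
  have hlocal : mlieBracket I Y (f • Z) =ᶠ[𝓝 x]
      (fun y ↦ mvfderiv I f y (Y y)) • Z + f • mlieBracket I Y Z := by
    filter_upwards [eventually_mdifferentiableAt hf, eventually_mdifferentiableAt hZ]
      with y hfy hZy using mlieBracket_smul_right hfy hZy
  rw [EventuallyEq.rfl.mlieBracket_vectorField_eq hlocal,
    mlieBracket_add_right (hYf.smul_section hZ') (hf'.smul_section hYZ),
    mlieBracket_smul_right hYf hZ', mlieBracket_smul_right hf' hYZ]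

theorem mvfderiv_mlieBracket [FiniteDimensional ℝ E] (hX : CMDiffAt ∞ (T% X) x)
    (hY : CMDiffAt ∞ (T% Y) x) (hf : CMDiffAt ∞ f x) :
    mvfderiv I f x (mlieBracket I X Y x) =
      mvfderiv I (fun y ↦ mvfderiv I f y (Y y)) x (X x)
        - mvfderiv I (fun y ↦ mvfderiv I f y (X y)) x (Y x) := by
  rcases subsingleton_or_nontrivial (TangentSpace I x) with _ | _
  · simp [Subsingleton.elim (_ : TangentSpace I x) 0]
  obtain ⟨z, hz⟩ := exists_ne (0 : TangentSpace I x)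
  have hZ : CMDiffAt ∞ (T% (extend E z)) x := contMDiffAt_extend I E z
  -- Compare the coefficients of `Z` in the Jacobi identity for `X`, `Y` and `f • Z`.
  have hjacobi := mlieBracket_mlieBracket hX hY (hf.smul_section hZ)
  rw [mlieBracket_mlieBracket_smul hY hZ hf, mlieBracket_mlieBracket_smul hX hZ hf,
    mlieBracket_smul_right (hf.mdifferentiableAt (by simp)) (hZ.mdifferentiableAt (by simp)),
    mlieBracket_mlieBracket hX hY hZ, extend_apply_self] at hjacobi
  refine sub_eq_zero.1 ((smul_eq_zero.1 ?_).resolve_right hz)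
  linear_combination (norm := module) -hjacobi

end VectorFields

section Riemannian

variable {E : Type*} [NormedAddCommGroup E] [NormedSpace ℝ E]
  {H : Type*} [TopologicalSpace H] {I : ModelWithCorners ℝ E H}
  {M : Type*} [TopologicalSpace M] [ChartedSpace H M] [IsManifold I ∞ M]
  [RiemannianBundle (fun x : M ↦ TangentSpace I x)]
  {x : M} {f : M → ℝ} {T V W X Y Z : Π y : M, TangentSpace I y}
  {J : Π x : M, TangentSpace I x →L[ℝ] TangentSpace I x}

namespace IsHermitian

theorem isOrthogonalComplex (hJ : IsHermitian J) (x : M) :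
    IsOrthogonalComplex (J x : Module.End ℝ (TangentSpace I x)) where
  map_map := hJ.sq x
  inner_map_map := hJ.orthogonal x

theorem inner_map_left (hJ : IsHermitian J) (x : M) (v w : TangentSpace I x) :
    (inner ℝ (J x v) w : ℝ) = -inner ℝ v (J x w) :=
  (hJ.isOrthogonalComplex x).inner_map_left v w

theorem contMDiffAt_map (hJ : IsHermitian J) (hV : CMDiffAt ∞ (T% V) x) :
    CMDiffAt ∞ (T% (fun y ↦ J y (V y))) x :=
  ContMDiffAt.clm_bundle_apply (E₁ := fun x : M ↦ TangentSpace I x)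
    (E₂ := fun x : M ↦ TangentSpace I x) (F₁ := E) (F₂ := E) (b := fun y ↦ y) (hJ.contMDiff x) hV

theorem mdifferentiableAt_map (hJ : IsHermitian J) (hV : MDiffAt (T% V) x) :
    MDiffAt (T% (fun y ↦ J y (V y))) x :=
  MDifferentiableAt.clm_bundle_apply (E₁ := fun x : M ↦ TangentSpace I x)
    (E₂ := fun x : M ↦ TangentSpace I x) (F₁ := E) (F₂ := E) (b := fun y ↦ y)
    ((hJ.contMDiff x).mdifferentiableAt (by simp)) hV

end IsHermitian

/-! ### Smoothness of the metric and of the Levi-Civita connection -/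

variable [IsContMDiffRiemannianBundle I ∞ E (fun x : M ↦ TangentSpace I x)]

theorem contMDiffAt_inner (hX : CMDiffAt ∞ (T% X) x) (hY : CMDiffAt ∞ (T% Y) x) :
    CMDiffAt ∞ (fun y ↦ (inner ℝ (X y) (Y y) : ℝ)) x :=
  ContMDiffAt.inner_bundle (E := fun x : M ↦ TangentSpace I x) (F := E) (b := fun y ↦ y)
    (IB := I) hX hY

theorem contMDiffAt_wedge (hX : CMDiffAt ∞ (T% X) x) (hY : CMDiffAt ∞ (T% Y) x)
    (hZ : CMDiffAt ∞ (T% Z) x) : CMDiffAt ∞ (T% (fun y ↦ wedge (X y) (Y y) (Z y))) x := by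
  simp only [wedge_apply]
  exact ((contMDiffAt_inner hX hZ).smul_section hY).sub_section
    ((contMDiffAt_inner hY hZ).smul_section hX)

theorem contMDiffAt_norm (hX : CMDiffAt ∞ (T% X) x) (hx : X x ≠ 0) :
    CMDiffAt ∞ (fun y ↦ ‖X y‖) x := by
  have hsqrt : ContDiffAt ℝ ∞ Real.sqrt (inner ℝ (X x) (X x)) :=
    Real.contDiffAt_sqrt (inner_self_ne_zero.2 hx)
  simp_rw [norm_eq_sqrt_real_inner]
  exact hsqrt.contMDiffAt.comp x (contMDiffAt_inner hX hX)

theorem contMDiffAt_gramSchmidt {n : ℕ} {s : Fin n → Π y : M, TangentSpace I y}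
    (hs : ∀ i, CMDiffAt ∞ (T% (s i)) x) (hli : LinearIndependent ℝ (s · x)) (i : Fin n) :
    CMDiffAt ∞ (T% (fun y ↦ gramSchmidt ℝ (s · y) i)) x := by
  induction i using WellFoundedLT.induction with
  | ind i ih =>
    have hsum : CMDiffAt ∞ (T% (fun y ↦ ∑ j ∈ Finset.Iio i,
        (inner ℝ (gramSchmidt ℝ (s · y) j) (s i y) / ‖gramSchmidt ℝ (s · y) j‖ ^ 2) •
          gramSchmidt ℝ (s · y) j)) x := by
      refine ContMDiffAt.sum_section fun j hj ↦ ?_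
      have hj := ih j (Finset.mem_Iio.1 hj)
      have hne := gramSchmidt_ne_zero j hli
      exact ((contMDiffAt_inner hj (hs i)).div₀ ((contMDiffAt_norm hj hne).pow 2)
        (pow_ne_zero 2 (norm_ne_zero_iff.2 hne))).smul_section hj
    convert! (hs i).sub_section hsum using 3 with y
    exact eq_sub_of_add_eq (gramSchmidt_def'' ℝ (s · y) i).symm

variable [FiniteDimensional ℝ E]

variable (I) in
theorem exists_orthonormalFrame (x : M) :
    ∃ e : Π y : M, OrthonormalBasis (Fin (Module.finrank ℝ E)) ℝ (TangentSpace I y),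
      ∀ i, CMDiffAt ∞ (T% (e · i)) x := by
  let t := trivializationAt E (TangentSpace I : M → Type _) x
  let s (i) (y : M) : TangentSpace I y := t.localFrame (Module.finBasis ℝ E) i y
  have ht : x ∈ t.baseSet := mem_baseSet_trivializationAt E _ x
  have hs (i) : CMDiffAt ∞ (T% (s i)) x := contMDiffAt_localFrame_of_mem _ _ _ i ht
  have hli {y : M} (hy : y ∈ t.baseSet) : LinearIndependent ℝ (s · y) :=
    (t.isLocalFrameOn_localFrame_baseSet I ∞ _).linearIndependent hy
  refine ⟨fun y ↦ gramSchmidtOrthonormalBasis (𝕜 := ℝ) (Fintype.card_fin _).symm (s · y),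
    fun i ↦ ?_⟩
  have hg := contMDiffAt_gramSchmidt hs (hli ht) i
  refine (((contMDiffAt_norm hg (gramSchmidt_ne_zero i (hli ht))).inv₀
    (norm_ne_zero_iff.2 (gramSchmidt_ne_zero i (hli ht)))).smul_section hg).congr_of_eventuallyEq ?_
  filter_upwards [t.open_baseSet.mem_nhds ht] with y hy
  have hne : gramSchmidtNormed ℝ (s · y) i ≠ 0 :=
    norm_ne_zero_iff.1 (by simp [gramSchmidtNormed_unit_length i (hli hy)])
  congr 1
  exact gramSchmidtOrthonormalBasis_apply _ hne

theorem contMDiffAt_of_inner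
    (h : ∀ W : Π y : M, TangentSpace I y, CMDiffAt ∞ (T% W) x →
      CMDiffAt ∞ (fun y ↦ (inner ℝ (Z y) (W y) : ℝ)) x) : CMDiffAt ∞ (T% Z) x := by
  obtain ⟨e, he⟩ := exists_orthonormalFrame I x
  have hsum : CMDiffAt ∞ (T% (fun y ↦ ∑ i, (inner ℝ (Z y) (e y i) : ℝ) • e y i)) x :=
    ContMDiffAt.sum_section fun i _ ↦ (h _ (he i)).smul_section (he i)
  convert! hsum using 3 with y
  simp_rw [real_inner_comm _ (Z y)]
  exact ((e y).sum_repr' (Z y)).symm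

theorem contMDiffAt_leviCivita (hX : CMDiffAt ∞ (T% X) x) (hY : CMDiffAt ∞ (T% Y) x) :
    CMDiffAt ∞ (T% (fun y ↦ leviCivita I M Y y (X y))) x := by
  refine contMDiffAt_of_inner fun W hW ↦ ?_
  have hkoszul : CMDiffAt ∞ (koszul I Y X W) x :=
    (((((contMDiffAt_mvfderiv_apply (contMDiffAt_inner hY hW) hX).add
      (contMDiffAt_mvfderiv_apply (contMDiffAt_inner hW hX) hY)).sub
      (contMDiffAt_mvfderiv_apply (contMDiffAt_inner hX hY) hW)).add
      (contMDiffAt_inner (contMDiffAt_mlieBracket hX hY) hW)).sub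
      (contMDiffAt_inner (contMDiffAt_mlieBracket hY hW) hX)).sub
      (contMDiffAt_inner (contMDiffAt_mlieBracket hX hW) hY)
  refine (contMDiffAt_const (c := (2⁻¹ : ℝ)).mul hkoszul).congr_of_eventuallyEq ?_
  filter_upwards [eventually_mdifferentiableAt hX, eventually_mdifferentiableAt hY,
    eventually_mdifferentiableAt hW] with y hXy hYy hWy
  exact inner_leviCivitaFun hYy hXy hWy

/-! ### Symmetries of the curvature tensor -/

theorem leviCivita_add (hY : MDiffAt (T% Y) x) (hZ : MDiffAt (T% Z) x) (u : TangentSpace I x) :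
    leviCivita I M (fun y ↦ Y y + Z y) x u = leviCivita I M Y x u + leviCivita I M Z x u := by
  have := (leviCivita I M).isCovariantDerivativeOnUniv.add hY hZ
  exact congr($this u)

theorem leviCivita_sub (hY : MDiffAt (T% Y) x) (hZ : MDiffAt (T% Z) x) (u : TangentSpace I x) :
    leviCivita I M (fun y ↦ Y y - Z y) x u = leviCivita I M Y x u - leviCivita I M Z x u := by
  have hsub : MDiffAt (T% (fun y ↦ Y y - Z y)) x := mdifferentiableAt_sub_section hY hZ
  have := leviCivita_add hsub hZ u
  simp only [sub_add_cancel] at this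
  exact eq_sub_of_add_eq this.symm

theorem leviCivita_smul (hf : MDiffAt f x) (hY : MDiffAt (T% Y) x) (u : TangentSpace I x) :
    leviCivita I M (fun y ↦ f y • Y y) x u =
      f x • leviCivita I M Y x u + mvfderiv I f x u • Y x := by
  have := (leviCivita I M).isCovariantDerivativeOnUniv.leibniz hY hf
  exact congr($this u)

theorem leviCivita_const_smul (c : ℝ) (hY : MDiffAt (T% Y) x) (u : TangentSpace I x) :
    leviCivita I M (fun y ↦ c • Y y) x u = c • leviCivita I M Y x u := by
  have := (leviCivita I M).isCovariantDerivativeOnUniv.smul_const c hY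
  exact congr($this u)

theorem leviCivita_neg (hY : MDiffAt (T% Y) x) (u : TangentSpace I x) :
    leviCivita I M (fun y ↦ -Y y) x u = -leviCivita I M Y x u := by
  simpa only [neg_one_smul] using leviCivita_const_smul (-1) hY u

theorem leviCivita_congr (hY : MDiffAt (T% Y) x) (hZ : MDiffAt (T% Z) x) (h : Y =ᶠ[𝓝 x] Z) :
    leviCivita I M Y x = leviCivita I M Z x :=
  (leviCivita I M).isCovariantDerivativeOnUniv.congr_of_eventuallyEq hY hZ Filter.univ_mem h

theorem mvfderiv_inner (hY : MDiffAt (T% Y) x) (hZ : MDiffAt (T% Z) x) (u : TangentSpace I x) :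
    mvfderiv I (fun y ↦ (inner ℝ (Y y) (Z y) : ℝ)) x u =
      inner ℝ (leviCivita I M Y x u) (Z x) + inner ℝ (Y x) (leviCivita I M Z x u) := by
  have := mvfderiv_inner_eq (mdifferentiableAt_extend I E u) hY hZ
  rwa [extend_apply_self] at this

theorem mvfderiv_mvfderiv_inner (hY : CMDiffAt ∞ (T% Y) x) (hW : CMDiffAt ∞ (T% W) x)
    (hZ : CMDiffAt ∞ (T% Z) x) (u : TangentSpace I x) :
    mvfderiv I (fun y ↦ mvfderiv I (fun y ↦ (inner ℝ (W y) (Z y) : ℝ)) y (Y y)) x u =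
      inner ℝ (leviCivita I M (fun y ↦ leviCivita I M W y (Y y)) x u) (Z x)
        + inner ℝ (leviCivita I M W x (Y x)) (leviCivita I M Z x u)
        + (inner ℝ (leviCivita I M W x u) (leviCivita I M Z x (Y x))
        + inner ℝ (W x) (leviCivita I M (fun y ↦ leviCivita I M Z y (Y y)) x u)) := by
  have hYW := contMDiffAt_leviCivita hY hW
  have hYZ := contMDiffAt_leviCivita hY hZ
  have hlocal : (fun y ↦ mvfderiv I (fun y ↦ (inner ℝ (W y) (Z y) : ℝ)) y (Y y)) =ᶠ[𝓝 x]
      (fun y ↦ (inner ℝ (leviCivita I M W y (Y y)) (Z y) : ℝ)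
        + inner ℝ (W y) (leviCivita I M Z y (Y y))) := by
    filter_upwards [eventually_mdifferentiableAt hW, eventually_mdifferentiableAt hZ]
      with y hWy hZy using mvfderiv_inner hWy hZy (Y y)
  have hW' := hW.mdifferentiableAt (by simp)
  have hZ' := hZ.mdifferentiableAt (by simp)
  have hYW' := hYW.mdifferentiableAt (by simp)
  have hYZ' := hYZ.mdifferentiableAt (by simp)
  rw [mvfderiv_congr_of_eventuallyEq hlocal,
    mvfderiv_fun_add (mdifferentiableAt_inner hYW' hZ') (mdifferentiableAt_inner hW' hYZ'),
    add_apply, mvfderiv_inner hYW' hZ', mvfderiv_inner hW' hYZ']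

theorem inner_curvature_left (hX : CMDiffAt ∞ (T% X) x) (hY : CMDiffAt ∞ (T% Y) x)
    (hW : CMDiffAt ∞ (T% W) x) (hZ : CMDiffAt ∞ (T% Z) x) :
    (inner ℝ (curvature X Y W x) (Z x) : ℝ) = -inner ℝ (W x) (curvature X Y Z x) := by
  have hbracket := mvfderiv_mlieBracket hX hY (contMDiffAt_inner hW hZ)
  rw [mvfderiv_mvfderiv_inner hY hW hZ, mvfderiv_mvfderiv_inner hX hW hZ,
    mvfderiv_inner (hW.mdifferentiableAt (by simp)) (hZ.mdifferentiableAt (by simp))] at hbracket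
  simp only [curvature, inner_sub_left, inner_sub_right]
  linear_combination -hbracket

theorem curvature_congr_right (hX : CMDiffAt ∞ (T% X) x) (hY : CMDiffAt ∞ (T% Y) x)
    (hW : CMDiffAt ∞ (T% W) x) (hZ : CMDiffAt ∞ (T% Z) x) (h : W x = Z x) :
    curvature X Y W x = curvature X Y Z x := by
  refine ext_inner_right ℝ fun z ↦ ?_
  have hz : CMDiffAt ∞ (T% (extend E z)) x := contMDiffAt_extend I E z
  rw [← extend_apply_self (F := E) z, inner_curvature_left hX hY hW hz,
    inner_curvature_left hX hY hZ hz, h]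

theorem curvature_swap (X Y Z : Π y : M, TangentSpace I y) (x : M) :
    curvature Y X Z x = -curvature X Y Z x := by
  simp only [curvature, mlieBracket_swap_apply (V := Y), map_neg]
  abel

theorem leviCivita_leviCivita_sub_swap (hX : CMDiffAt ∞ (T% X) x) (hY : CMDiffAt ∞ (T% Y) x)
    (hZ : CMDiffAt ∞ (T% Z) x) :
    leviCivita I M (fun y ↦ leviCivita I M Z y (Y y)) x (X x)
        - leviCivita I M (fun y ↦ leviCivita I M Y y (Z y)) x (X x)
        - leviCivita I M X x (mlieBracket I Y Z x) =
      mlieBracket I X (mlieBracket I Y Z) x := by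
  have hYZ := contMDiffAt_leviCivita hY hZ
  have hZY := contMDiffAt_leviCivita hZ hY
  have hlocal : (fun y ↦ leviCivita I M Z y (Y y) - leviCivita I M Y y (Z y)) =ᶠ[𝓝 x]
      mlieBracket I Y Z := by
    filter_upwards [eventually_mdifferentiableAt hY, eventually_mdifferentiableAt hZ]
      with y hYy hZy using leviCivita_sub_swap hYy hZy
  have hbracket := (contMDiffAt_mlieBracket hY hZ).mdifferentiableAt (by simp)
  have hsub : MDiffAt (T% (fun y ↦ leviCivita I M Z y (Y y) - leviCivita I M Y y (Z y))) x :=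
    (hYZ.sub_section hZY).mdifferentiableAt (by simp)
  rw [← leviCivita_sub (hYZ.mdifferentiableAt (by simp)) (hZY.mdifferentiableAt (by simp)),
    leviCivita_congr hsub hbracket hlocal,
    leviCivita_sub_swap (hX.mdifferentiableAt (by simp)) hbracket]

theorem curvature_cyclic (hX : CMDiffAt ∞ (T% X) x) (hY : CMDiffAt ∞ (T% Y) x)
    (hZ : CMDiffAt ∞ (T% Z) x) :
    curvature X Y Z x + curvature Y Z X x + curvature Z X Y x = 0 := by
  have hXZ := (contMDiffAt_mlieBracket hX hZ).mdifferentiableAt (by simp)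
  have hneg : mlieBracket I Y (mlieBracket I Z X) x = -mlieBracket I Y (mlieBracket I X Z) x := by
    rw [mlieBracket_swap (V := Z), ← neg_one_smul ℝ (mlieBracket I X Z),
      mlieBracket_const_smul_right hXZ, neg_one_smul]
  have hjacobi := mlieBracket_mlieBracket hX hY hZ
  rw [mlieBracket_swap_apply (V := mlieBracket I X Y), ← neg_eq_iff_eq_neg.2 hneg,
    ← leviCivita_leviCivita_sub_swap hX hY hZ, ← leviCivita_leviCivita_sub_swap hY hZ hX,
    ← leviCivita_leviCivita_sub_swap hZ hX hY, ← sub_eq_zero] at hjacobi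
  rw [← hjacobi]
  simp only [curvature]
  abel

/-- The curvature endomorphism `w ↦ R_{u,v} w` of the tangent space at `x`. -/
def curvatureEnd (x : M) (u v : TangentSpace I x) : Module.End ℝ (TangentSpace I x) :=
  have hskew (w z : TangentSpace I x) :
      (inner ℝ (curvature (extend E u) (extend E v) (extend E w) x) z : ℝ) =
        -inner ℝ w (curvature (extend E u) (extend E v) (extend E z) x) := by
    have := inner_curvature_left (contMDiffAt_extend I E u) (contMDiffAt_extend I E v)
      (contMDiffAt_extend I E w) (contMDiffAt_extend I E z)
    rwa [extend_apply_self, extend_apply_self] at this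
  { toFun w := curvature (extend E u) (extend E v) (extend E w) x
    map_add' w w' := ext_inner_right ℝ fun z ↦ by
      simp only [hskew, inner_add_left, neg_add]
    map_smul' c w := ext_inner_right ℝ fun z ↦ by
      simp only [hskew, real_inner_smul_left, RingHom.id_apply, mul_neg] }

theorem curvatureEnd_extend (u v : TangentSpace I x) (hZ : CMDiffAt ∞ (T% Z) x) :
    curvatureEnd x u v (Z x) = curvature (extend E u) (extend E v) Z x :=
  curvature_congr_right (contMDiffAt_extend I E u) (contMDiffAt_extend I E v)
    (contMDiffAt_extend I E (Z x)) hZ (extend_apply_self ..)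

theorem inner_curvatureEnd_swap_left (u v w z : TangentSpace I x) :
    (inner ℝ (curvatureEnd x v u w) z : ℝ) = -inner ℝ (curvatureEnd x u v w) z := by
  rw [← inner_neg_left]
  exact congr(inner ℝ $(curvature_swap (extend E u) (extend E v) (extend E w) x) z)

theorem inner_curvatureEnd_swap_right (u v w z : TangentSpace I x) :
    (inner ℝ (curvatureEnd x u v z) w : ℝ) = -inner ℝ (curvatureEnd x u v w) z := by
  have := inner_curvature_left (contMDiffAt_extend I E u) (contMDiffAt_extend I E v)
    (contMDiffAt_extend I E z) (contMDiffAt_extend I E w)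
  rw [extend_apply_self, extend_apply_self, real_inner_comm _ z] at this
  exact this

theorem inner_curvatureEnd_cyclic (u v w z : TangentSpace I x) :
    (inner ℝ (curvatureEnd x u v w) z : ℝ) + inner ℝ (curvatureEnd x v w u) z
      + inner ℝ (curvatureEnd x w u v) z = 0 := by
  rw [← inner_add_left, ← inner_add_left, ← inner_zero_left (𝕜 := ℝ) z]
  exact congr(inner ℝ $(curvature_cyclic (contMDiffAt_extend I E u) (contMDiffAt_extend I E v)
    (contMDiffAt_extend I E w)) z)

theorem inner_curvatureEnd_pair_symm (u v w z : TangentSpace I x) :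
    (inner ℝ (curvatureEnd x u v w) z : ℝ) = inner ℝ (curvatureEnd x w z u) v := by
  let r (u v w z : TangentSpace I x) : ℝ := inner ℝ (curvatureEnd x u v w) z
  have hleft (u v w z) : r v u w z = -r u v w z := inner_curvatureEnd_swap_left u v w z
  have hright (u v w z) : r u v z w = -r u v w z := inner_curvatureEnd_swap_right u v w z
  have hcyclic (u v w z) : r u v w z + r v w u z + r w u v z = 0 :=
    inner_curvatureEnd_cyclic u v w z
  change r u v w z = r w z u v
  linarith [hcyclic u v w z, hcyclic v w z u, hcyclic w z u v, hcyclic z u v w, hright u v w z,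
    hright w z u v, hright v w u z, hleft w u z v, hright w u v z, hleft z v u w, hright z v w u,
    hright z u w v]

/-! ### The Weyl connection of a vector field -/

/-- The connection `D_u Z = ∇_u Z + (u ∧ T) Z / 2`, the metric part of the Weyl connection
attached to the vector field `T`. -/
def weylDeriv (T Z : Π y : M, TangentSpace I y) (x : M) (u : TangentSpace I x) :
    TangentSpace I x :=
  leviCivita I M Z x u + (2⁻¹ : ℝ) • wedge u (T x) (Z x)

/-- The endomorphism `S = ∇T / 2 + T ⊗ T / 4 - |T|² / 8`, by which the curvature of the connection
`weylDeriv T` differs from the Riemannian one: `R^D_{u,v} = R_{u,v} - (u ∧ S v - v ∧ S u)`. -/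
def schoutenShift (T : Π y : M, TangentSpace I y) (x : M) : Module.End ℝ (TangentSpace I x) :=
  (2⁻¹ : ℝ) • (leviCivita I M T x : Module.End ℝ (TangentSpace I x))
    + (4⁻¹ : ℝ) • (innerₗ (TangentSpace I x) (T x)).smulRight (T x)
    - (8⁻¹ * ‖T x‖ ^ 2 : ℝ) • LinearMap.id

theorem schoutenShift_apply (T : Π y : M, TangentSpace I y) (x : M) (u : TangentSpace I x) :
    schoutenShift T x u = (2⁻¹ : ℝ) • leviCivita I M T x u
      + (4⁻¹ * inner ℝ (T x) u : ℝ) • T x - (8⁻¹ * ‖T x‖ ^ 2 : ℝ) • u := by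
  simp [schoutenShift, mul_smul]

theorem leviCivita_wedge (hX : MDiffAt (T% X) x) (hY : MDiffAt (T% Y) x)
    (hZ : MDiffAt (T% Z) x) (u : TangentSpace I x) :
    leviCivita I M (fun y ↦ wedge (X y) (Y y) (Z y)) x u =
      wedge (leviCivita I M X x u) (Y x) (Z x) + wedge (X x) (leviCivita I M Y x u) (Z x)
        + wedge (X x) (Y x) (leviCivita I M Z x u) := by
  have hXZ := mdifferentiableAt_inner hX hZ
  have hYZ := mdifferentiableAt_inner hY hZ
  have hXZY : MDiffAt (T% (fun y ↦ (inner ℝ (X y) (Z y) : ℝ) • Y y)) x := hXZ.smul_section hY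
  have hYZX : MDiffAt (T% (fun y ↦ (inner ℝ (Y y) (Z y) : ℝ) • X y)) x := hYZ.smul_section hX
  simp only [wedge_apply]
  rw [leviCivita_sub hXZY hYZX, leviCivita_smul hXZ hY,
    leviCivita_smul hYZ hX, mvfderiv_inner hX hZ, mvfderiv_inner hY hZ]
  module

theorem contMDiffAt_weylDeriv (hT : CMDiffAt ∞ (T% T) x) (hX : CMDiffAt ∞ (T% X) x)
    (hZ : CMDiffAt ∞ (T% Z) x) : CMDiffAt ∞ (T% (fun y ↦ weylDeriv T Z y (X y))) x :=
  (contMDiffAt_leviCivita hX hZ).add_section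
    ((contMDiffAt_wedge hX hT hZ).const_smul_section (a := (2⁻¹ : ℝ)))

theorem weylDeriv_weylDeriv (hT : CMDiffAt ∞ (T% T) x) (hY : CMDiffAt ∞ (T% Y) x)
    (hZ : CMDiffAt ∞ (T% Z) x) (u : TangentSpace I x) :
    weylDeriv T (fun y ↦ weylDeriv T Z y (Y y)) x u =
      leviCivita I M (fun y ↦ leviCivita I M Z y (Y y)) x u
        + (2⁻¹ : ℝ) • (wedge (leviCivita I M Y x u) (T x) (Z x)
          + wedge (Y x) (leviCivita I M T x u) (Z x) + wedge (Y x) (T x) (leviCivita I M Z x u)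
          + wedge u (T x) (leviCivita I M Z x (Y x)))
        + (4⁻¹ : ℝ) • wedge u (T x) (wedge (Y x) (T x) (Z x)) := by
  have hYZ := (contMDiffAt_leviCivita hY hZ).mdifferentiableAt (by simp)
  have hYTZ := (contMDiffAt_wedge hY hT hZ).mdifferentiableAt (by simp)
  have hYTZ' : MDiffAt (T% (fun y ↦ (2⁻¹ : ℝ) • wedge (Y y) (T y) (Z y))) x :=
    mdifferentiableAt_const.smul_section hYTZ
  rw [weylDeriv]
  simp only [weylDeriv]
  rw [leviCivita_add hYZ hYTZ', leviCivita_const_smul _ hYTZ,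
    leviCivita_wedge (hY.mdifferentiableAt (by simp)) (hT.mdifferentiableAt (by simp))
      (hZ.mdifferentiableAt (by simp)), map_add, map_smul]
  module

theorem weylDeriv_curvature (hT : CMDiffAt ∞ (T% T) x) (hX : CMDiffAt ∞ (T% X) x)
    (hY : CMDiffAt ∞ (T% Y) x) (hZ : CMDiffAt ∞ (T% Z) x) :
    weylDeriv T (fun y ↦ weylDeriv T Z y (Y y)) x (X x)
        - weylDeriv T (fun y ↦ weylDeriv T Z y (X y)) x (Y x)
        - weylDeriv T Z x (mlieBracket I X Y x) =
      curvature X Y Z x - metricWedge (schoutenShift T x) (X x) (Y x) (Z x) := by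
  rw [weylDeriv_weylDeriv hT hY hZ, weylDeriv_weylDeriv hT hX hZ, weylDeriv, curvature,
    metricWedge_apply, ← leviCivita_sub_swap (hX.mdifferentiableAt (by simp))
      (hY.mdifferentiableAt (by simp))]
  simp only [schoutenShift_apply, map_add, map_sub, map_smul, LinearMap.add_apply,
    LinearMap.sub_apply, LinearMap.smul_apply, wedge_apply, ← real_inner_self_eq_norm_sq]
  rw [real_inner_comm (X x) (Y x), real_inner_comm (X x) (T x), real_inner_comm (Y x) (T x)]
  module

theorem weylDeriv_congr (hY : MDiffAt (T% Y) x) (hZ : MDiffAt (T% Z) x) (h : Y =ᶠ[𝓝 x] Z)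
    (u : TangentSpace I x) : weylDeriv T Y x u = weylDeriv T Z x u := by
  rw [weylDeriv, weylDeriv, leviCivita_congr hY hZ h, h.eq_of_nhds]

theorem trace_schoutenShift (T : Π y : M, TangentSpace I y) (x : M) :
    trace ℝ (TangentSpace I x) (schoutenShift T x) =
      2⁻¹ * trace ℝ (TangentSpace I x) (leviCivita I M T x : Module.End ℝ (TangentSpace I x))
        + (2 - Module.finrank ℝ E) / 8 * ‖T x‖ ^ 2 := by
  have hE : Module.finrank ℝ (TangentSpace I x) = Module.finrank ℝ E := rfl
  rw [schoutenShift, map_sub, map_add, map_smul, map_smul, map_smul, LinearMap.trace_smulRight,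
    LinearMap.trace_id, innerₗ_apply_apply, real_inner_self_eq_norm_sq, hE]
  simp only [smul_eq_mul]
  ring

/-! ### The covariant derivative of the complex structure and the Lee form -/

namespace IsHermitian

theorem inner_leviCivita_map_sub (hJ : IsHermitian J) (hV : MDiffAt (T% V) x)
    (hW : MDiffAt (T% W) x) (u : TangentSpace I x) :
    (inner ℝ (leviCivita I M (fun y ↦ J y (V y)) x u - J x (leviCivita I M V x u)) (W x) : ℝ) =
      -inner ℝ (V x) (leviCivita I M (fun y ↦ J y (W y)) x u - J x (leviCivita I M W x u)) := by
  have hJV := mvfderiv_inner (hJ.mdifferentiableAt_map hV) hW u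
  have hJW := mvfderiv_inner hV (hJ.mdifferentiableAt_map hW) u
  have hneg := mvfderiv_neg (I := I) (x := x) (g := fun y ↦ (inner ℝ (V y) (J y (W y)) : ℝ))
  have hfun : (fun y ↦ (inner ℝ (J y (V y)) (W y) : ℝ)) = -fun y ↦ inner ℝ (V y) (J y (W y)) :=
    funext fun y ↦ hJ.inner_map_left y _ _
  rw [hfun, hneg, neg_apply, hJW, hJ.inner_map_left] at hJV
  rw [inner_sub_left, inner_sub_right, hJ.inner_map_left]
  linear_combination -hJV

/-- The covariant derivative of `J` at the point `x`: `hJ.covDeriv x u v` is `(∇_u J) v`. -/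
def covDeriv (hJ : IsHermitian J) (x : M) :
    TangentSpace I x →ₗ[ℝ] Module.End ℝ (TangentSpace I x) :=
  have hskew (u v w : TangentSpace I x) :
      (inner ℝ (leviCivita I M (fun y ↦ J y (extend E v y)) x u
        - J x (leviCivita I M (extend E v) x u)) w : ℝ) =
      -inner ℝ v (leviCivita I M (fun y ↦ J y (extend E w y)) x u
        - J x (leviCivita I M (extend E w) x u)) := by
    have := hJ.inner_leviCivita_map_sub (mdifferentiableAt_extend I E v)
      (mdifferentiableAt_extend I E w) u
    rwa [extend_apply_self, extend_apply_self] at this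
  LinearMap.mk₂ ℝ (fun u v ↦ leviCivita I M (fun y ↦ J y (extend E v y)) x u
      - J x (leviCivita I M (extend E v) x u))
    (fun u u' v ↦ by simp only [map_add]; abel)
    (fun c u v ↦ by simp only [map_smul, smul_sub])
    (fun u v v' ↦ ext_inner_right ℝ fun w ↦ by
      simp only [hskew, inner_add_left, neg_add])
    (fun c u v ↦ ext_inner_right ℝ fun w ↦ by
      simp only [hskew, real_inner_smul_left, mul_neg])

theorem inner_covDeriv (hJ : IsHermitian J) (u v w : TangentSpace I x) :
    (inner ℝ (hJ.covDeriv x u v) w : ℝ) = -inner ℝ v (hJ.covDeriv x u w) := by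
  have := hJ.inner_leviCivita_map_sub (mdifferentiableAt_extend I E v)
    (mdifferentiableAt_extend I E w) u
  rwa [extend_apply_self, extend_apply_self] at this

theorem leviCivita_map (hJ : IsHermitian J) (hV : MDiffAt (T% V) x) (u : TangentSpace I x) :
    leviCivita I M (fun y ↦ J y (V y)) x u =
      J x (leviCivita I M V x u) + hJ.covDeriv x u (V x) := by
  refine eq_add_of_sub_eq' (ext_inner_right ℝ fun w ↦ ?_)
  have := hJ.inner_leviCivita_map_sub hV (mdifferentiableAt_extend I E w) u
  rw [extend_apply_self] at this
  rw [this, hJ.inner_covDeriv]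
  rfl

theorem covDeriv_map_right (hJ : IsHermitian J) (u v : TangentSpace I x) :
    hJ.covDeriv x u (J x v) = -J x (hJ.covDeriv x u v) := by
  have hv := mdifferentiableAt_extend I E v
  have hsq := hJ.leviCivita_map (hJ.mdifferentiableAt_map hv) u
  simp only [hJ.sq] at hsq
  rw [leviCivita_neg hv, hJ.leviCivita_map hv, extend_apply_self, map_add, hJ.sq, add_assoc,
    left_eq_add] at hsq
  exact eq_neg_of_add_eq_zero_right hsq

theorem covDeriv_map_left (hJ : IsHermitian J) (u v : TangentSpace I x) :
    hJ.covDeriv x (J x u) v = J x (hJ.covDeriv x u v) := by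
  let P (u v : TangentSpace I x) := hJ.covDeriv x (J x u) v - J x (hJ.covDeriv x u v)
  have hsymm (u v : TangentSpace I x) : P u v = P v u := by
    have hu := mdifferentiableAt_extend I E u
    have hv := mdifferentiableAt_extend I E v
    have hJu := hJ.mdifferentiableAt_map hu
    have hJv := hJ.mdifferentiableAt_map hv
    have hN := hJ.integrable _ _ x hu hv
    rw [nijenhuis, ← leviCivita_sub_swap hJu hJv, ← leviCivita_sub_swap hu hv,
      ← leviCivita_sub_swap hJu hv, ← leviCivita_sub_swap hu hJv] at hN
    simp only [hJ.leviCivita_map hu, hJ.leviCivita_map hv, extend_apply_self, map_add,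
      map_sub, hJ.sq] at hN
    rw [← sub_eq_zero, ← hN]
    simp only [P]
    abel
  have hskew (u v w : TangentSpace I x) : (inner ℝ (P u v) w : ℝ) = -inner ℝ v (P u w) := by
    simp only [P, inner_sub_left, inner_sub_right]
    rw [hJ.inner_covDeriv, hJ.inner_map_left, hJ.inner_covDeriv, hJ.covDeriv_map_right,
      inner_neg_right]
    ring
  exact sub_eq_zero.1 (eq_zero_of_symm_of_skew hsymm hskew u v)

end IsHermitian

/-- The vector field metrically dual to the Lee form. -/
def leeField (J : Π x : M, TangentSpace I x →L[ℝ] TangentSpace I x) (x : M) : TangentSpace I x :=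
  ∑ i, leeForm J x (stdOrthonormalBasis ℝ (TangentSpace I x) i) •
    stdOrthonormalBasis ℝ (TangentSpace I x) i

namespace IsHermitian

theorem covDerivTwo_fundamentalForm (hJ : IsHermitian J) (u v w : TangentSpace I x) :
    covDerivTwo (fundamentalForm J) x u v w = inner ℝ (hJ.covDeriv x u v) w := by
  have hv := mdifferentiableAt_extend I E v
  have hω := mvfderiv_inner (hJ.mdifferentiableAt_map hv) (mdifferentiableAt_extend I E w) u
  simp only [covDerivTwo, fundamentalForm]
  rw [hω, hJ.leviCivita_map hv, extend_apply_self, extend_apply_self, inner_add_left]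
  ring

theorem codiffTwo_fundamentalForm (hJ : IsHermitian J) (w : TangentSpace I x) :
    codiffTwo (fundamentalForm J) x w =
      trace ℝ (TangentSpace I x) ((hJ.covDeriv x).flip w) := by
  rw [codiffTwo, LinearMap.trace_eq_sum_inner _ (stdOrthonormalBasis ℝ (TangentSpace I x)),
    ← Finset.sum_neg_distrib]
  simp only [hJ.covDerivTwo_fundamentalForm, hJ.inner_covDeriv, neg_neg, LinearMap.flip_apply]

theorem leeForm_apply (hJ : IsHermitian J) (w : TangentSpace I x) :
    leeForm J x w = -trace ℝ (TangentSpace I x) ((hJ.covDeriv x).flip (J x w)) := by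
  rw [leeForm, actOne, hJ.codiffTwo_fundamentalForm]

theorem inner_leeField (hJ : IsHermitian J) (w : TangentSpace I x) :
    (inner ℝ (leeField J x) w : ℝ) = leeForm J x w := by
  let θ : TangentSpace I x →ₗ[ℝ] ℝ :=
    -(trace ℝ (TangentSpace I x)) ∘ₗ (hJ.covDeriv x).flip ∘ₗ (J x : _ →ₗ[ℝ] _)
  have hθ (w : TangentSpace I x) : leeForm J x w = θ w := hJ.leeForm_apply w
  simp only [leeField, sum_inner, real_inner_smul_left, hθ]
  conv_rhs => rw [← (stdOrthonormalBasis ℝ (TangentSpace I x)).sum_repr' w]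
  simp only [map_sum, map_smul, smul_eq_mul, mul_comm]

theorem trace_covDeriv_flip (hJ : IsHermitian J) (w : TangentSpace I x) :
    trace ℝ (TangentSpace I x) ((hJ.covDeriv x).flip w) = -inner ℝ (J x (leeField J x)) w := by
  rw [hJ.inner_map_left, neg_neg, hJ.inner_leeField, hJ.leeForm_apply, hJ.sq, map_neg, map_neg,
    neg_neg]

theorem normSqOne_leeForm (hJ : IsHermitian J) (x : M) :
    normSqOne (leeForm J) x = ‖leeField J x‖ ^ 2 := by
  rw [← (stdOrthonormalBasis ℝ (TangentSpace I x)).sum_sq_inner_left]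
  simp only [normSqOne, hJ.inner_leeField]

theorem leeForm_eq_sum (hJ : IsHermitian J) (hV : MDiffAt (T% V) x) {ι : Type*} [Fintype ι]
    (e : OrthonormalBasis ι ℝ (TangentSpace I x)) :
    leeForm J x (V x) = ∑ i, inner ℝ (e i)
      (leviCivita I M V x (e i) + J x (leviCivita I M (fun y ↦ J y (V y)) x (e i))) := by
  rw [hJ.leeForm_apply, LinearMap.trace_eq_sum_inner _ e, ← Finset.sum_neg_distrib]
  refine Finset.sum_congr rfl fun i _ ↦ ?_
  have hsq := hJ.leviCivita_map (hJ.mdifferentiableAt_map hV) (e i)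
  simp only [hJ.sq] at hsq
  rw [leviCivita_neg hV, ← sub_eq_iff_eq_add'] at hsq
  rw [LinearMap.flip_apply, ← hsq, ← inner_neg_right, neg_sub, sub_neg_eq_add, add_comm]

theorem contMDiffAt_leeField (hJ : IsHermitian J) (x : M) : CMDiffAt ∞ (T% (leeField J)) x := by
  obtain ⟨e, he⟩ := exists_orthonormalFrame I x
  refine contMDiffAt_of_inner fun W hW ↦ ?_
  have hsum : CMDiffAt ∞ (fun y ↦ ∑ i, (inner ℝ (e y i) (leviCivita I M W y (e y i)
      + J y (leviCivita I M (fun y ↦ J y (W y)) y (e y i))) : ℝ)) x :=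
    ContMDiffAt.sum fun i _ ↦ contMDiffAt_inner (he i)
      ((contMDiffAt_leviCivita (he i) hW).add_section
        (hJ.contMDiffAt_map (contMDiffAt_leviCivita (he i) (hJ.contMDiffAt_map hW))))
  refine hsum.congr_of_eventuallyEq ?_
  filter_upwards [eventually_mdifferentiableAt hW] with y hWy
  rw [hJ.inner_leeField, hJ.leeForm_eq_sum hWy (e y)]

theorem covDerivOne_leeForm (hJ : IsHermitian J) (v w : TangentSpace I x) :
    covDerivOne (leeForm J) x v w = inner ℝ (leviCivita I M (leeField J) x v) w := by
  have hθ := mvfderiv_inner ((hJ.contMDiffAt_leeField x).mdifferentiableAt (by simp))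
    (mdifferentiableAt_extend I E w) v
  simp only [covDerivOne, ← hJ.inner_leeField]
  rw [hθ, extend_apply_self]
  ring

theorem codiffOne_leeForm (hJ : IsHermitian J) (x : M) :
    codiffOne (leeForm J) x =
      -trace ℝ (TangentSpace I x) (leviCivita I M (leeField J) x : _ →ₗ[ℝ] _) := by
  rw [codiffOne, LinearMap.trace_eq_sum_inner _ (stdOrthonormalBasis ℝ (TangentSpace I x))]
  simp only [hJ.covDerivOne_leeForm, ContinuousLinearMap.coe_coe, real_inner_comm]

/-! ### Gray's condition on Hermitian surfaces -/

theorem weylDeriv_leeField_map (hJ : IsHermitian J) (hE : Module.finrank ℝ E = 4)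
    (hV : MDiffAt (T% V) x) (u : TangentSpace I x) :
    weylDeriv (leeField J) (fun y ↦ J y (V y)) x u = J x (weylDeriv (leeField J) V x u) := by
  have hcov := (hJ.isOrthogonalComplex x).two_smul_eq_lie_wedge hE hJ.inner_covDeriv
    hJ.covDeriv_map_right hJ.covDeriv_map_left hJ.trace_covDeriv_flip u
  have hcovV : (2 : ℝ) • hJ.covDeriv x u (V x) =
    J x (wedge u (leeField J x) (V x)) - wedge u (leeField J x) (J x (V x)) := congr($hcov (V x))
  rw [weylDeriv, weylDeriv, hJ.leviCivita_map hV, map_add, map_smul]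
  linear_combination (norm := module) (2⁻¹ : ℝ) • hcovV

theorem weylDeriv_weylDeriv_leeField_map (hJ : IsHermitian J) (hE : Module.finrank ℝ E = 4)
    (hY : CMDiffAt ∞ (T% Y) x) (hZ : CMDiffAt ∞ (T% Z) x) (u : TangentSpace I x) :
    weylDeriv (leeField J) (fun y ↦ weylDeriv (leeField J) (fun y ↦ J y (Z y)) y (Y y)) x u =
      J x (weylDeriv (leeField J) (fun y ↦ weylDeriv (leeField J) Z y (Y y)) x u) := by
  have hT := hJ.contMDiffAt_leeField x
  have hDZ := contMDiffAt_weylDeriv hT hY hZ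
  have hDJZ := contMDiffAt_weylDeriv hT hY (hJ.contMDiffAt_map hZ)
  rw [← hJ.weylDeriv_leeField_map hE (hDZ.mdifferentiableAt (by simp))]
  refine weylDeriv_congr (hDJZ.mdifferentiableAt (by simp))
    ((hJ.contMDiffAt_map hDZ).mdifferentiableAt (by simp)) ?_ u
  filter_upwards [eventually_mdifferentiableAt hZ] with y hZy
  exact hJ.weylDeriv_leeField_map hE hZy (Y y)

theorem lie_curvatureEnd (hJ : IsHermitian J) (hE : Module.finrank ℝ E = 4)
    (u v : TangentSpace I x) :
    ⁅(J x : Module.End ℝ (TangentSpace I x)), curvatureEnd x u v⁆ =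
      ⁅(J x : Module.End ℝ (TangentSpace I x)),
        metricWedge (schoutenShift (leeField J) x) u v⁆ := by
  refine LinearMap.ext fun w ↦ ?_
  have hT := hJ.contMDiffAt_leeField x
  have hu : CMDiffAt ∞ (T% (extend E u)) x := contMDiffAt_extend I E u
  have hv : CMDiffAt ∞ (T% (extend E v)) x := contMDiffAt_extend I E v
  have hw : CMDiffAt ∞ (T% (extend E w)) x := contMDiffAt_extend I E w
  have hD := weylDeriv_curvature hT hu hv hw
  have hDJ := weylDeriv_curvature hT hu hv (hJ.contMDiffAt_map hw)
  rw [hJ.weylDeriv_weylDeriv_leeField_map hE hv hw, hJ.weylDeriv_weylDeriv_leeField_map hE hu hw,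
    hJ.weylDeriv_leeField_map hE (hw.mdifferentiableAt (by simp)), ← map_sub, ← map_sub, hD,
    ← curvatureEnd_extend u v (hJ.contMDiffAt_map hw), ← curvatureEnd_extend u v hw,
    map_sub] at hDJ
  simp only [extend_apply_self] at hDJ
  simp only [Ring.lie_def, LinearMap.sub_apply, Module.End.mul_apply, ContinuousLinearMap.coe_coe]
  linear_combination (norm := module) hDJ

theorem forall_riemann_eq_iff (hJ : IsHermitian J) (hE : Module.finrank ℝ E = 4) (x : M) :
    (∀ u v w z : TangentSpace I x, riemann x u v w z = riemann x u v (J x w) (J x z)) ↔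
      trace ℝ (TangentSpace I x) (schoutenShift (leeField J) x) = 0 ∧
        Commute (J x : Module.End ℝ (TangentSpace I x)) (schoutenShift (leeField J) x) := by
  rw [← (hJ.isOrthogonalComplex x).forall_lie_eq_zero_iff hE inner_curvatureEnd_pair_symm
    (hJ.lie_curvatureEnd hE)]
  simp only [← commute_iff_lie_eq, (hJ.isOrthogonalComplex x).commute_iff_inner_map_map]
  rfl

theorem trace_schoutenShift_leeField_eq_zero_iff (hJ : IsHermitian J)
    (hE : Module.finrank ℝ E = 4) (x : M) :
    trace ℝ (TangentSpace I x) (schoutenShift (leeField J) x) = 0 ↔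
      2 * codiffOne (leeForm J) x = -normSqOne (leeForm J) x := by
  rw [trace_schoutenShift, hE, hJ.codiffOne_leeForm, hJ.normSqOne_leeForm]
  constructor <;> intro h <;> linarith

theorem commute_schoutenShift_leeField_iff (hJ : IsHermitian J) (x : M) :
    Commute (J x : Module.End ℝ (TangentSpace I x)) (schoutenShift (leeField J) x) ↔
      ∀ v w, antiInvariantPart J (covDerivOne (leeForm J)) x v w =
        -(1 / 4) * (leeForm J x v * leeForm J x w
          - actOne J (leeForm J) x v * actOne J (leeForm J) x w) := by
  rw [(hJ.isOrthogonalComplex x).commute_iff_inner_map_map]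
  refine forall₂_congr fun v w ↦ ?_
  simp only [antiInvariantPart, actOne, hJ.covDerivOne_leeForm, schoutenShift_apply,
    ContinuousLinearMap.coe_coe, inner_sub_left, inner_add_left, real_inner_smul_left,
    hJ.inner_leeField, hJ.orthogonal]
  constructor <;> intro h <;> linarith

end IsHermitian

end Riemannian

end HermitianSurface

end

theorem proposition5p6_general {E : Type*} [NormedAddCommGroup E] [NormedSpace ℝ E]
    [FiniteDimensional ℝ E] (hE : Module.finrank ℝ E = 4)
    {H : Type*} [TopologicalSpace H] {I : ModelWithCorners ℝ E H}
    {M : Type*} [TopologicalSpace M] [ChartedSpace H M] [IsManifold I ∞ M]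
    [RiemannianBundle (fun x : M ↦ TangentSpace I x)]
    [IsContMDiffRiemannianBundle I ∞ E (fun x : M ↦ TangentSpace I x)]
    (J : Π x : M, TangentSpace I x →L[ℝ] TangentSpace I x)
    (hJ : HermitianSurface.IsHermitian J) (θ : Π x : M, TangentSpace I x → ℝ)
    (hθ : θ = HermitianSurface.leeForm J) :
    HermitianSurface.GrayFirst J ↔
      (∀ x : M, 2 * HermitianSurface.codiffOne θ x = -HermitianSurface.normSqOne θ x) ∧
      (∀ (x : M) (v w : TangentSpace I x),
        HermitianSurface.antiInvariantPart J (HermitianSurface.covDerivOne θ) x v w =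
          -(1 / 4) * (θ x v * θ x w
            - HermitianSurface.actOne J θ x v * HermitianSurface.actOne J θ x w)) := by
  subst hθ
  rw [← forall_and]
  refine forall_congr' fun x ↦ ?_
  rw [hJ.forall_riemann_eq_iff hE, hJ.trace_schoutenShift_leeField_eq_zero_iff hE,
    hJ.commute_schoutenShift_leeField_iff]

theorem proposition5p6 {M : Type*} [TopologicalSpace M] [ChartedSpace (EuclideanSpace ℝ (Fin 4)) M]
    [IsManifold (𝓡 4) ∞ M]
    [RiemannianBundle (fun x : M ↦ TangentSpace (𝓡 4) x)]
    [IsContMDiffRiemannianBundle (𝓡 4) ∞ (EuclideanSpace ℝ (Fin 4))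
      (fun x : M ↦ TangentSpace (𝓡 4) x)]
    (J : Π x : M, TangentSpace (𝓡 4) x →L[ℝ] TangentSpace (𝓡 4) x)
    (hJ : HermitianSurface.IsHermitian J)
    (θ : Π x : M, TangentSpace (𝓡 4) x → ℝ) (hθ : θ = HermitianSurface.leeForm J) :
    HermitianSurface.GrayFirst J ↔
      (∀ x : M, 2 * HermitianSurface.codiffOne θ x = -HermitianSurface.normSqOne θ x) ∧
      (∀ (x : M) (v w : TangentSpace (𝓡 4) x),
        HermitianSurface.antiInvariantPart J (HermitianSurface.covDerivOne θ) x v w =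
          -(1 / 4) * (θ x v * θ x w
            - HermitianSurface.actOne J θ x v * HermitianSurface.actOne J θ x w)) :=
  proposition5p6_general (by simp) J hJ θ hθ
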